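/- Let $\mathcal A$ be a finite alphabet with $d\ge 2$ letters. A combinatorial datum is a pair $\pi=(\pi_0,\pi_1)$ of bijections $\mathcal A\to\{1,\dots,d\}$; it is irreducible if $\pi_1\circ\pi_0^{-1}(\{1,\dots,s\})\ne\{1,\dots,s\}$ for $1\le s\le d-1$, and it has genus one if the interval exchanges with datum $\pi$ have at most two discontinuities, i.e. at most two letters $\beta$ with $\pi_0(\beta)>1$ are such that the letter $\alpha$ with $\pi_0(\alpha)=\pi_0(\beta)-1$ does not satisfy $\pi_1(\alpha)=\pi_1(\beta)-1$. Let $\Omega_\pi$ be the antisymmetric $\mathcal A\times\mathcal A$ matrix with entry $(\alpha,\beta)$ equal to $+1$ if $\pi_1(\alpha)>\pi_1(\beta)$ and $\pi_0(\alpha)<\pi_0(\beta)$, to $-1$ if $\pi_1(\alpha)<\pi_1(\beta)$ and $\pi_0(\alpha)>\pi_0(\beta)$, and to $0$ otherwise. For $\varepsilon\in\{0,1\}$ let $\alpha(\varepsilon)$ be the letter with $\pi_\varepsilon(\alpha(\varepsilon))=d$; in the Rauzy move of type $\varepsilon$ the winner is $\alpha(\varepsilon)$ and the loser is $\alpha(1-\varepsilon)$.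 The datum $r_\varepsilon(\pi)$ is obtained from $\pi$ by moving, in row $1-\varepsilon$, the loser from the last place to the place immediately to the right of the winner, and $\Theta_{\pi,\varepsilon}=I+E_{\alpha(1-\varepsilon)\,\alpha(\varepsilon)}$. Let $\gamma=(\pi^n,\varepsilon^n)_{n\ge0}$ be an admissible sequence, i.e. $\pi^{n+1}=r_{\varepsilon^n}(\pi^n)$ for all $n$, with $\pi^0$ irreducible and of genus one. Write $\alpha^n(\varepsilon)$ for the last letter of row $\varepsilon$ of $\pi^n$, and put $\Theta_n=\Theta_{\pi^n,\varepsilon^n}$, $\Theta_{m,n}=\Theta_n\Theta_{n-1}\cdots\Theta_m$. Assume that $\gamma$ is $k$-bounded: for all $n$ and $\beta,\delta\in\mathcal A$ there are $n_1,p\ge0$ with $|n-n_1|<k$, $|n-n_1-p|<k$, $\alpha^{n_1}(\varepsilon^{n_1})=\beta$, $\alpha^{n_1+p}(1-\varepsilon^{n_1+p})=\delta$ and $\alpha^{n_1+i}(1-\varepsilon^{n_1+p})=\alpha^{n_1+i+1}(\varepsilon^{n_1+i})$ for $0\le i<p$. (This covers the combinatorics of every generalized interval exchange map of genus one without connections and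 with $k$-bounded combinatorics.) For $n\ge0$ a periodic approximation of order $n$ is an admissible sequence $\gamma_n$ that agrees with $\gamma$ at the indices $i\le n$ and is periodic with a period $p_n\ge\max(n,1)$. For $j\le n$ let $M_{j,n}$ be the product of the $p_n$ cocycle matrices of $\gamma_n$ starting with the index $j$, and let $\Psi_{j,p_n}:\ker\Omega_{\pi^j}\to\operatorname{Im}\Omega_{\pi^j}$ be the linear map $\Psi_{j,p_n}(\kappa)=(M_{j,n}-\mathrm{Id})^{-1}(\kappa-M_{j,n}\kappa)$, the inverse being taken on $\operatorname{Im}\Omega_{\pi^j}$; its graph $\{\kappa+\Psi_{j,p_n}(\kappa)\}$ is the central direction of $M_{j,n}$. Then periodic approximations of every order exist, and there is a constant $C>1$ depending only on $d$ and $k$ such that, for every choice $(\gamma_n)_{n\ge0}$ of periodic approximations of $\gamma$ of order $n$, the following hold. (1) For every $j$ and all sufficiently large $n$ (depending on $j$), $\Psi_{j,p_n}$ is well defined, i.e. there is exactly one linear map $\Psi:\ker\Omega_{\pi^j}\to\operatorname{Im}\Omega_{\pi^j}$ with $(M_{j,n}-\mathrm{Id})\Psi(\kappa)=\kappa-M_{j,n}\kappa$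 for all $\kappa\in\ker\Omega_{\pi^j}$. (2) There is a strictly increasing sequence of integers $n$ along which $\Psi_{j,p_n}$ converges for every $j\ge0$. (3) Along every strictly increasing sequence of integers $n$ such that $\Psi_{j,p_n}$ converges to a limit $\Psi_{j,\infty}$ for every $j\ge0$, the graphs $E^c_{j,\infty}=\{\kappa+\Psi_{j,\infty}(\kappa):\kappa\in\ker\Omega_{\pi^j}\}$ satisfy $\dim E^c_{j,\infty}=d-2$ and $\Theta_j(E^c_{j,\infty})=E^c_{j+1,\infty}$ for all $j\ge0$, and $$\frac1C\,\|v\|\le\|\Theta_{0,n}v\|\le C\,\|v\|\qquad\text{for all } v\in E^c_{0,\infty}\text{ and all } n\ge0,$$ where $\|\cdot\|$ is the Euclidean norm. -/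

import Mathlib

open Filter Topology

/-- Combinatorial data `π = (π₀, π₁)` over the alphabet `A` with `d = Fintype.card A` letters:
`π ε α` is the position (counted from `0`) of the letter `α` in row `ε ∈ {0, 1}`. -/
abbrev CombData (A : Type*) [Fintype A] : Type _ := Fin 2 → (A ≃ Fin (Fintype.card A))

namespace CombData

variable {A : Type*} [Fintype A]

/-- Irreducibility: no proper initial segment of row `0` is an initial segment of row `1`. -/
def Irred (π : CombData A) : Prop :=
  ∀ s : ℕ, 1 ≤ s → s ≤ Fintype.card A - 1 →
    (fun i => π 1 ((π 0).symm i)) '' {i : Fin (Fintype.card A) | (i : ℕ) < s} ≠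
      {i : Fin (Fintype.card A) | (i : ℕ) < s}

/-- The letters `β` at whose left endpoint a generalized interval exchange with combinatorial
data `π` is discontinuous: `β` is not the first letter of row `0`, and the letter preceding it
in row `0` does not precede it immediately in row `1`. -/
def discontinuities (π : CombData A) : Set A :=
  {β | 0 < (π 0 β : ℕ) ∧
    ¬ ∃ α, (π 0 α : ℕ) + 1 = (π 0 β : ℕ) ∧ (π 1 α : ℕ) + 1 = (π 1 β : ℕ)}

/-- Genus one: at most two discontinuities. -/
def GenusOne (π : CombData A) : Prop := π.discontinuities.ncard ≤ 2

/-- The antisymmetric matrix `Ω_π`. -/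
def Omega (π : CombData A) : Matrix A A ℝ := fun α β =>
  if π 1 β < π 1 α ∧ π 0 α < π 0 β then 1
  else if π 1 α < π 1 β ∧ π 0 β < π 0 α then -1
  else 0

/-- `Ker Ω_π` as a subspace of `ℝ^A`. -/
abbrev kerOmega (π : CombData A) : Submodule ℝ (A → ℝ) := LinearMap.ker π.Omega.mulVecLin

/-- `Im Ω_π` as a subspace of `ℝ^A`. -/
abbrev imOmega (π : CombData A) : Submodule ℝ (A → ℝ) := LinearMap.range π.Omega.mulVecLin

/-- The letter `α(ε)` in the last position of row `ε`. For a step of type `ε` the winner is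
`α(ε)` and the loser is `α(1 - ε)`. -/
def lastLetter [Nontrivial A] (π : CombData A) (ε : Fin 2) : A :=
  (π ε).symm ⟨Fintype.card A - 1, Nat.sub_lt Fintype.card_pos Nat.one_pos⟩

/-- The change of positions when the last entry of a row of length `d` is moved to the place
immediately to the right of position `w`. -/
def moveLast {d : ℕ} (w i : Fin d) : Fin d :=
  if h : (i : ℕ) ≤ w then i
  else if h' : (i : ℕ) = d - 1 then ⟨w + 1, by omega⟩
  else ⟨i + 1, by omega⟩

theorem moveLast_bijective {d : ℕ} (w : Fin d) : Function.Bijective (moveLast w) := by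
  apply Finite.injective_iff_bijective.mp
  intro i j hij
  have hi := i.isLt
  have hj := j.isLt
  unfold moveLast at hij
  ext
  split_ifs at hij <;> simp only [Fin.ext_iff] at hij <;> omega

/-- The Rauzy move `r_ε`: row `ε` is unchanged; in row `1 - ε` the loser `α(1 - ε)` is moved from
the last place to the place immediately to the right of the winner `α(ε)`. -/
noncomputable def rauzy [Nontrivial A] (ε : Fin 2) (π : CombData A) : CombData A :=
  Function.update π (1 - ε)
    ((π (1 - ε)).trans
      (Equiv.ofBijective _ (moveLast_bijective (π (1 - ε) (π.lastLetter ε)))))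

/-- The matrix `Θ_{π,ε} = I + E_{α(1-ε) α(ε)}` of the Rauzy–Veech cocycle. -/
def Theta [Nontrivial A] [DecidableEq A] (π : CombData A) (ε : Fin 2) : Matrix A A ℝ :=
  1 + Matrix.single (π.lastLetter (1 - ε)) (π.lastLetter ε) 1

/-- `Ψ : Ker Ω_π → Im Ω_π` satisfies `(M - Id) (Ψ κ) = κ - M κ` for every `κ ∈ Ker Ω_π`, that is,
`Ψ = (M - Id)⁻¹ ∘ (Id - M)` with the inverse taken on `Im Ω_π`. -/
def IsCentralMap (π : CombData A) (M : Matrix A A ℝ) (Ψ : π.kerOmega →ₗ[ℝ] π.imOmega) : Prop :=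
  ∀ κ : π.kerOmega,
    M.mulVec (Ψ κ : A → ℝ) - (Ψ κ : A → ℝ) = (κ : A → ℝ) - M.mulVec (κ : A → ℝ)

open Classical in
/-- The map whose graph is the central direction of a loop at `π` with matrix `M`
(by convention `0` if the defining equation does not determine a unique map). -/
noncomputable def centralMap (π : CombData A) (M : Matrix A A ℝ) :
    π.kerOmega →ₗ[ℝ] π.imOmega :=
  if h : ∃! Ψ : π.kerOmega →ₗ[ℝ] π.imOmega, π.IsCentralMap M Ψ then h.choose else 0

/-- The graph `{κ + Ψ κ : κ ∈ Ker Ω_π}` as a subspace of `ℝ^A`. -/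
noncomputable def graphSpace (π : CombData A) (Ψ : π.kerOmega →ₗ[ℝ] π.imOmega) :
    Submodule ℝ (A → ℝ) :=
  LinearMap.range (π.kerOmega.subtype + π.imOmega.subtype ∘ₗ Ψ)

end CombData

/-- A sequence `(π^n, ε^n)` of combinatorial data and types. -/
abbrev CombSeq (A : Type*) [Fintype A] : Type _ := ℕ → CombData A × Fin 2

namespace CombSeq

variable {A : Type*} [Fintype A] [Nontrivial A]

/-- `π^{n+1} = r_{ε^n}(π^n)` for all `n`. -/
def Admissible (γ : CombSeq A) : Prop := ∀ n, (γ (n + 1)).1 = CombData.rauzy (γ n).2 (γ n).1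

/-- The letter `α^n(ε)`: the last letter of row `ε` of `π^n`. -/
def letter (γ : CombSeq A) (n : ℕ) (ε : Fin 2) : A := (γ n).1.lastLetter ε

/-- `k`-bounded combinatorics. -/
def KBounded (k : ℕ) (γ : CombSeq A) : Prop :=
  ∀ (n : ℕ) (β δ : A), ∃ n₁ p : ℕ,
    |(n : ℤ) - n₁| < k ∧ |(n : ℤ) - n₁ - p| < k ∧
    γ.letter n₁ (γ n₁).2 = β ∧
    γ.letter (n₁ + p) (1 - (γ (n₁ + p)).2) = δ ∧
    ∀ i < p, γ.letter (n₁ + i) (1 - (γ (n₁ + p)).2) = γ.letter (n₁ + i + 1) (γ (n₁ + i)).2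

/-- `Θ_n = Θ_{π^n, ε^n}`. -/
def theta [DecidableEq A] (γ : CombSeq A) (n : ℕ) : Matrix A A ℝ := (γ n).1.Theta (γ n).2

/-- The product `Θ_{j+m-1} ⋯ Θ_{j+1} Θ_j` of the `m` matrices starting with the index `j`. -/
def cocycle [DecidableEq A] (γ : CombSeq A) (j : ℕ) : ℕ → Matrix A A ℝ
  | 0 => 1
  | m + 1 => γ.theta (j + m) * cocycle γ j m

/-- A periodic admissible sequence that agrees with `γ` up to the index `n` and closes up,
returning to `(π^0, ε^0)` at the index `period ≥ n`. -/
structure PeriodicApprox (γ : CombSeq A) (n : ℕ) where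
  seq : CombSeq A
  period : ℕ
  period_pos : 0 < period
  le_period : n ≤ period
  admissible : seq.Admissible
  agrees : ∀ i ≤ n, seq i = γ i
  periodic : ∀ i, seq (i + period) = seq i

/-- The matrix of one period of the approximating sequence, starting with the index `j`. -/
def PeriodicApprox.loop [DecidableEq A] {γ : CombSeq A} {n : ℕ} (c : γ.PeriodicApprox n)
    (j : ℕ) : Matrix A A ℝ := c.seq.cocycle j c.period

/-- Along the subsequence `φ`, for every `j` the maps `Ψ_{j,p_n}` whose graphs are the central
directions of the periodic approximations (at the index `j`) converge to `Ψ j`.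
For `n ≥ j` the approximation has combinatorial data `π^j` at the index `j`. -/
def IsCentralLimit [DecidableEq A] (γ : CombSeq A) (c : ∀ n, γ.PeriodicApprox n) (φ : ℕ → ℕ)
    (Ψ : ∀ j, (γ j).1.kerOmega →ₗ[ℝ] (γ j).1.imOmega) : Prop :=
  ∀ (j : ℕ) (κ : (γ j).1.kerOmega),
    Tendsto (fun m => (γ j).1.centralMap ((c (φ m)).loop j) κ) atTop (𝓝 (Ψ j κ))

end CombSeq

/-! An irreducible datum of genus one has rows `X Y Z` and `Z Y X` with `Y` possibly empty, and
Rauzy moves preserve this form (`IsBlock.hasBlocks_rauzy`). For such data the linear map `jump`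
records the differences of `v` between neighbouring letters, and the defect from additivity where
`Y` begins. It is invariant under the cocycle (`HasBlocks.jump_Theta_mulVec`), and its kernel is `Im
Ω_π` (`HasBlocks.imOmega_eq_ker_jump`). Hence a loop matrix `M` acts trivially modulo `Im Ω_π`, and
the defining equation of `Ψ` says precisely that `M` fixes `κ + Ψ κ`.

The key estimate is that a vector fixed by a loop is bounded by a constant times its jumps
(`Admissible.norm_le_of_fixed`). Jumps being constant along the orbit, the vector is known at each
time, up to bounded error, from its values `a`, `b` at the first letters of the two rows. These
evolve by the additive Euclid algorithm, `a ↦ a + b` or `b ↦ a + b`, with errors bounded by the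
jumps. Along a periodic orbit, large values of equal sign would grow forwards and large values of
opposite sign would grow backwards, so one of `a`, `b` is always small. Since `k`-boundedness makes
both kinds of step occur soon, both are bounded (`abs_le_of_periodic`).

Everything else follows from this estimate. Fixed vectors without jumps vanish, so `M - Id` is
invertible on `Im Ω_π` and `Ψ` is unique. The maps `Ψ` are uniformly bounded, so compactness gives
limits. The cocycle is a quasi-isometry on central directions because the norm at either time is
comparable to the same jumps. Invariance and the two bounds are closed conditions and pass to the
limit. -/

/-! ### Permutations with at most two discontinuities -/

/-- A map with at most two discontinuities that preserves no proper initial segment of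
`{0, …, d - 1}` reverses the order of two or three consecutive blocks. -/
theorem exists_blocks_of_injOn {d : ℕ} (hd : 2 ≤ d) {f : ℕ → ℕ} (hlt : ∀ i < d, f i < d)
    (hinj : ∀ i < d, ∀ j < d, f i = f j → i = j)
    (hirr : ∀ s, 1 ≤ s → s ≤ d - 1 → ¬ ∀ i < s, f i < s)
    (h3 : ∀ i j k, 0 < i → i < j → j < k → k < d → f i ≠ f (i - 1) + 1 → f j ≠ f (j - 1) + 1 →
      f k ≠ f (k - 1) + 1 → False) :
    ∃ r s t, 0 < r ∧ 0 < t ∧ r + s + t = d ∧ ∀ i < d,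
      (i < r ∧ f i = i + s + t) ∨ (r ≤ i ∧ i < r + s ∧ f i + r = i + t) ∨
        (r + s ≤ i ∧ f i + r + s = i) := by
  have run : ∀ p q, q ≤ d → (∀ i, p < i → i < q → f i = f (i - 1) + 1) →
      ∀ n, p + n < q → f (p + n) = f p + n := by
    intro p q _ h n
    induction n with
    | zero => intro _; rfl
    | succ n ih =>
      intro hn
      have h1 := ih (by omega)
      have h2 := h (p + (n + 1)) (by omega) hn
      rw [show p + (n + 1) - 1 = p + n by omega] at h2
      omega
  -- Two runs of translation have disjoint intervals as images, so the images are linearly ordered.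
  have disj : ∀ p q p' q', p < q → q ≤ p' → p' < q' → q' ≤ d →
      (∀ n, p + n < q → f (p + n) = f p + n) → (∀ n, p' + n < q' → f (p' + n) = f p' + n) →
      f p + (q - p) ≤ f p' ∨ f p' + (q' - p') ≤ f p := by
    intro p q p' q' h1 h2 h3 h4 r1 r2
    by_contra hcon
    push Not at hcon
    rcases le_total (f p) (f p') with hle | hle
    · have e := r1 (f p' - f p) (by omega)
      have := hinj (p + (f p' - f p)) (by omega) p' (by omega) (by omega)
      omega
    · have e := r2 (f p - f p') (by omega)
      have := hinj (p' + (f p - f p')) (by omega) p (by omega) (by omega)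
      omega
  have hex : ∃ i, 0 < i ∧ i < d ∧ f i ≠ f (i - 1) + 1 := by
    by_contra hcon
    push Not at hcon
    have h1 := run 0 d le_rfl (fun i hi hid => hcon i hi hid) (d - 1) (by omega)
    have h2 := hlt (0 + (d - 1)) (by omega)
    refine hirr 1 le_rfl (by omega) fun i hi => ?_
    obtain rfl : i = 0 := by omega
    omega
  classical
  let i₁ := Nat.find hex
  obtain ⟨hi0, hid, hi1⟩ : 0 < i₁ ∧ i₁ < d ∧ f i₁ ≠ f (i₁ - 1) + 1 := Nat.find_spec hex
  have hmin : ∀ i, 0 < i → i < i₁ → f i = f (i - 1) + 1 := by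
    intro i h1 h2
    have := Nat.find_min hex h2
    by_contra hne
    exact this ⟨h1, by omega, hne⟩
  clear_value i₁
  have r0 := run 0 i₁ hid.le hmin
  simp only [zero_add] at r0
  have hf0 : f 0 ≠ 0 := by
    intro h0
    refine hirr i₁ hi0 (by omega) fun i hi => ?_
    have := r0 i hi
    omega
  have e0 := r0 (i₁ - 1) (by omega)
  have l0 := hlt (i₁ - 1) (by omega)
  by_cases hex2 : ∃ i, i₁ < i ∧ i < d ∧ f i ≠ f (i - 1) + 1
  · let i₂ := Nat.find hex2
    obtain ⟨hj0, hjd, hj1⟩ : i₁ < i₂ ∧ i₂ < d ∧ f i₂ ≠ f (i₂ - 1) + 1 := Nat.find_spec hex2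
    have hmin2 : ∀ i, i₁ < i → i < i₂ → f i = f (i - 1) + 1 := by
      intro i h1 h2
      have := Nat.find_min hex2 h2
      by_contra hne
      exact this ⟨h1, by omega, hne⟩
    clear_value i₂
    have r1 := run i₁ i₂ hjd.le hmin2
    have r2 := run i₂ d le_rfl fun i h1 h2 => by
      by_contra hne
      exact h3 i₁ i₂ i hi0 hj0 h1 h2 hi1 hj1 hne
    have e1 := r1 (i₂ - 1 - i₁) (by omega)
    have e2 := r2 (d - 1 - i₂) (by omega)
    rw [show i₁ + (i₂ - 1 - i₁) = i₂ - 1 by omega] at e1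
    rw [show i₂ + (d - 1 - i₂) = d - 1 by omega] at e2
    have l1 := hlt (i₂ - 1) (by omega)
    have l2 := hlt (d - 1) (by omega)
    have d01 := disj 0 i₁ i₁ i₂ hi0 le_rfl hj0 hjd.le (by simpa using r0) r1
    have d02 := disj 0 i₁ i₂ d hi0 hj0.le hjd le_rfl (by simpa using r0) r2
    have d12 := disj i₁ i₂ i₂ d hj0 le_rfl hjd le_rfl r1 r2
    -- Of the six orders of the three images, irreducibility at `i₁` and `i₂` excludes those
    -- starting with `X` and the order `Y X Z`. The orders `Z X Y` and `Y Z X` would make `f`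
    -- continuous at `i₁` or at `i₂`. Only `Z Y X` remains.
    have hord : f i₂ = 0 ∧ f i₁ = d - i₂ ∧ f 0 = d - i₁ := by
      by_cases hs : f 0 + i₁ ≤ i₂ ∧ f i₁ + (i₂ - i₁) ≤ i₂
      · exfalso
        refine hirr i₂ (by omega) (by omega) fun i hi => ?_
        rcases lt_or_ge i i₁ with h | h
        · have := r0 i h; omega
        · have := r1 (i - i₁) (by omega)
          rw [show i₁ + (i - i₁) = i by omega] at this
          omega
      · omega
    refine ⟨i₁, i₂ - i₁, d - i₂, hi0, by omega, by omega, fun i hi => ?_⟩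
    rcases lt_or_ge i i₁ with h | h
    · have := r0 i h; omega
    · rcases lt_or_ge i i₂ with h' | h'
      · have := r1 (i - i₁) (by omega)
        rw [show i₁ + (i - i₁) = i by omega] at this
        omega
      · have := r2 (i - i₂) (by omega)
        rw [show i₂ + (i - i₂) = i by omega] at this
        omega
  · push Not at hex2
    have r1 := run i₁ d le_rfl fun i h1 h2 => hex2 i h1 h2
    have e1 := r1 (d - 1 - i₁) (by omega)
    rw [show i₁ + (d - 1 - i₁) = d - 1 by omega] at e1
    have l1 := hlt (d - 1) (by omega)
    have d01 := disj 0 i₁ i₁ d hi0 le_rfl hid le_rfl (by simpa using r0) r1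
    refine ⟨i₁, 0, d - i₁, hi0, by omega, by omega, fun i hi => ?_⟩
    rcases lt_or_ge i i₁ with h | h
    · have := r0 i h; omega
    · have := r1 (i - i₁) (by omega)
      rw [show i₁ + (i - i₁) = i by omega] at this
      omega

theorem Fin.two_one_sub_one_sub (ε : Fin 2) : 1 - (1 - ε) = ε := by
  fin_cases ε <;> rfl

theorem Fin.two_ne_one_sub (ε : Fin 2) : ε ≠ 1 - ε := by
  fin_cases ε <;> decide

theorem Fin.two_eq_one_sub_of_ne {δ ε : Fin 2} (h : δ ≠ ε) : δ = 1 - ε := by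
  revert δ ε; decide

/-! ### Block form of genus one data and its invariance under Rauzy moves -/

namespace CombData

variable {A : Type*} [Fintype A]

/-- Row `ε` of `π` is a concatenation of blocks `X Y Z` of lengths `r, s, t`, with `X` and `Z`
nonempty, and the other row is `Z Y X`. -/
structure IsBlock (π : CombData A) (ε : Fin 2) (r s t : ℕ) : Prop where
  left_pos : 0 < r
  right_pos : 0 < t
  card : r + s + t = Fintype.card A
  pos : ∀ α, ((π ε α : ℕ) < r ∧ (π (1 - ε) α : ℕ) = π ε α + s + t) ∨
    (r ≤ (π ε α : ℕ) ∧ (π ε α : ℕ) < r + s ∧ (π (1 - ε) α : ℕ) + r = π ε α + t) ∨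
    (r + s ≤ (π ε α : ℕ) ∧ (π (1 - ε) α : ℕ) + r + s = π ε α)

theorem IsBlock.symm {π : CombData A} {ε : Fin 2} {r s t : ℕ} (h : π.IsBlock ε r s t) :
    π.IsBlock (1 - ε) t s r := by
  refine ⟨h.right_pos, h.left_pos, by have := h.card; omega, fun α => ?_⟩
  rw [Fin.two_one_sub_one_sub]
  have := h.pos α
  have := h.card
  have := (π ε α).isLt
  omega

/-- The two rows of `π` are of the form `X Y Z` and `Z Y X`. -/
def HasBlocks (π : CombData A) : Prop := ∃ r s t, π.IsBlock 0 r s t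

theorem HasBlocks.exists_isBlock {π : CombData A} (h : π.HasBlocks) (ε : Fin 2) :
    ∃ r s t, π.IsBlock ε r s t := by
  obtain ⟨r, s, t, h⟩ := h
  fin_cases ε
  · exact ⟨r, s, t, h⟩
  · exact ⟨t, s, r, h.symm⟩

theorem IsBlock.hasBlocks {π : CombData A} {ε : Fin 2} {r s t : ℕ} (h : π.IsBlock ε r s t) :
    π.HasBlocks := by
  fin_cases ε
  · exact ⟨r, s, t, h⟩
  · exact ⟨t, s, r, h.symm⟩

theorem eq_of_pos_eq (π : CombData A) (ε : Fin 2) {α β : A} (h : (π ε α : ℕ) = π ε β) : α = β :=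
  (π ε).injective (Fin.ext h)

theorem exists_pos_eq (π : CombData A) (ε : Fin 2) {i : ℕ} (hi : i < Fintype.card A) :
    ∃ α, (π ε α : ℕ) = i :=
  ⟨(π ε).symm ⟨i, hi⟩, by simp⟩

theorem hasBlocks_of_irred_of_genusOne [Nontrivial A] {π : CombData A} (hirr : π.Irred)
    (hg : π.GenusOne) : π.HasBlocks := by
  classical
  set d := Fintype.card A with hd
  have hd2 : 2 ≤ d := Fintype.one_lt_card
  let f : ℕ → ℕ := fun i => if h : i < d then (π 1 ((π 0).symm ⟨i, h⟩) : ℕ) else 0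
  have hf : ∀ i (h : i < d), f i = (π 1 ((π 0).symm ⟨i, h⟩) : ℕ) := fun i h => by simp [f, h]
  have hfα : ∀ α, f (π 0 α) = (π 1 α : ℕ) := fun α => by
    rw [hf _ (π 0 α).isLt]; simp
  have hinj : ∀ i < d, ∀ j < d, f i = f j → i = j := by
    intro i hi j hj hij
    rw [hf i hi, hf j hj] at hij
    have := (π 0).symm.injective (π.eq_of_pos_eq 1 hij)
    simpa using this
  obtain ⟨r, s, t, hr, ht, hc, h⟩ := exists_blocks_of_injOn hd2 (f := f)
    (fun i hi => by rw [hf i hi]; exact Fin.isLt _) hinj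
    (by
      intro s hs1 hs2 hmap
      refine hirr s hs1 hs2 ?_
      have hsub : (fun i => π 1 ((π 0).symm i)) '' {i : Fin d | (i : ℕ) < s} ⊆
          {i : Fin d | (i : ℕ) < s} := by
        rintro _ ⟨i, hi, rfl⟩
        have := hmap i hi
        rw [hf i i.isLt] at this
        exact this
      refine Set.eq_of_subset_of_ncard_le hsub ?_ (Set.toFinite _)
      rw [Set.ncard_image_of_injective]
      exact ((π 0).symm.trans (π 1)).injective)
    (by
      intro i j k hi hij hjk hk h1 h2 h3
      have key : ∀ m, 0 < m → ∀ hm : m < d, f m ≠ f (m - 1) + 1 →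
          (π 0).symm ⟨m, hm⟩ ∈ π.discontinuities := by
        intro m hm0 hm hne
        refine ⟨by simpa using hm0, ?_⟩
        rintro ⟨α, e1, e2⟩
        apply hne
        rw [hf m hm, ← e2, ← hfα]
        simp only [Equiv.apply_symm_apply] at e1
        rw [show m - 1 = (π 0 α : ℕ) by omega]
      have hsub : ({(π 0).symm ⟨i, by omega⟩, (π 0).symm ⟨j, by omega⟩,
          (π 0).symm ⟨k, by omega⟩} : Set A) ⊆ π.discontinuities := by
        rintro x (rfl | rfl | rfl)
        · exact key _ hi _ h1
        · exact key _ (by omega) _ h2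
        · exact key _ (by omega) _ h3
      have hle := Set.ncard_le_ncard hsub (Set.toFinite _)
      have h3 : ({(π 0).symm ⟨i, by omega⟩, (π 0).symm ⟨j, by omega⟩,
          (π 0).symm ⟨k, by omega⟩} : Set A).ncard = 3 := by
        rw [Set.ncard_eq_three]
        refine ⟨_, _, _, ?_, ?_, ?_, rfl⟩ <;> simp <;> omega
      have : π.discontinuities.ncard ≤ 2 := hg
      omega)
  refine ⟨r, s, t, hr, ht, hc, fun α => ?_⟩
  have := h (π 0 α) (π 0 α).isLt
  rw [hfα] at this
  exact this

section Rauzy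

variable [Nontrivial A]

theorem pos_lastLetter (π : CombData A) (ε : Fin 2) :
    (π ε (π.lastLetter ε) : ℕ) = Fintype.card A - 1 := by
  simp [lastLetter]

theorem rauzy_apply_self (π : CombData A) (ε : Fin 2) : rauzy ε π ε = π ε :=
  Function.update_of_ne (Fin.two_ne_one_sub ε) _ _

theorem rauzy_apply_one_sub (π : CombData A) (ε : Fin 2) (α : A) :
    rauzy ε π (1 - ε) α = moveLast (π (1 - ε) (π.lastLetter ε)) (π (1 - ε) α) := by
  simp [rauzy]

theorem val_moveLast {d : ℕ} (w i : Fin d) : (moveLast w i : ℕ) =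
    if (i : ℕ) ≤ w then (i : ℕ) else if (i : ℕ) = d - 1 then (w : ℕ) + 1 else (i : ℕ) + 1 := by
  unfold moveLast
  split_ifs <;> rfl

theorem pos_rauzy_one_sub (π : CombData A) (ε : Fin 2) (α : A) :
    (rauzy ε π (1 - ε) α : ℕ) =
      if (π (1 - ε) α : ℕ) ≤ π (1 - ε) (π.lastLetter ε) then (π (1 - ε) α : ℕ)
      else if (π (1 - ε) α : ℕ) = Fintype.card A - 1 then (π (1 - ε) (π.lastLetter ε) : ℕ) + 1
      else (π (1 - ε) α : ℕ) + 1 := by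
  rw [rauzy_apply_one_sub, val_moveLast]

theorem lastLetter_rauzy (π : CombData A) (ε : Fin 2) :
    (rauzy ε π).lastLetter ε = π.lastLetter ε := by
  rw [lastLetter, rauzy_apply_self, lastLetter]

/-- The winner and its position in row `1 - ε` survive the move, and they determine which
permutation of places was applied. -/
theorem rauzy_injective (ε : Fin 2) : Function.Injective (rauzy (A := A) ε) := by
  intro π π' h
  have h1 : π ε = π' ε := by rw [← rauzy_apply_self π, h, rauzy_apply_self]
  have hl : π.lastLetter ε = π'.lastLetter ε := by rw [← lastLetter_rauzy, h, lastLetter_rauzy]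
  have hw : π (1 - ε) (π.lastLetter ε) = π' (1 - ε) (π'.lastLetter ε) := by
    have := congrArg (fun q : CombData A => (q (1 - ε) (π.lastLetter ε) : ℕ)) h
    simp only [pos_rauzy_one_sub] at this
    rw [← hl] at this
    simp only [le_refl, if_true] at this
    rw [← hl]
    exact Fin.ext this
  have h2 : π (1 - ε) = π' (1 - ε) := by
    ext1 α
    have := congrArg (fun q : CombData A => q (1 - ε) α) h
    simp only [rauzy_apply_one_sub, hw] at this
    exact (moveLast_bijective _).injective this
  funext δ
  by_cases hδ : δ = ε
  · rw [hδ, h1]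
  · rw [Fin.two_eq_one_sub_of_ne hδ, h2]

/-- Some path of Rauzy moves undoes a given one. -/
theorem exists_foldl_rauzy_rauzy (π : CombData A) (ε : Fin 2) :
    ∃ l : List (Fin 2), l.foldl (fun q δ => rauzy δ q) (rauzy ε π) = π := by
  classical
  let e : Equiv.Perm (CombData A) :=
    Equiv.ofBijective _ (Finite.injective_iff_bijective.mp (rauzy_injective ε))
  have hpow : ∀ n : ℕ, ∀ q : CombData A,
      (List.replicate n ε).foldl (fun q δ => rauzy δ q) q = (e ^ n) q := by
    intro n
    induction n with
    | zero => intro q; rfl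
    | succ n ih =>
      intro q
      rw [List.replicate_succ, List.foldl_cons, ih, pow_succ, Equiv.Perm.mul_apply]
      rfl
  -- The move permutes a finite set, so a power of it is its inverse.
  refine ⟨List.replicate (orderOf e - 1) ε, ?_⟩
  rw [hpow]
  change (e ^ (orderOf e - 1)) (e π) = π
  rw [← Equiv.Perm.mul_apply, ← pow_succ, Nat.sub_add_cancel (orderOf_pos e), pow_orderOf_eq_one]
  rfl

theorem pos_rauzy_eq_zero {π : CombData A} {ε δ : Fin 2} {α : A} (h : (π δ α : ℕ) = 0) :
    (rauzy ε π δ α : ℕ) = 0 := by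
  by_cases hδ : δ = ε
  · rw [hδ, rauzy_apply_self, ← hδ, h]
  · obtain rfl := Fin.two_eq_one_sub_of_ne hδ
    rw [pos_rauzy_one_sub, h]
    simp

theorem IsBlock.pos_winner {π : CombData A} {ε : Fin 2} {r s t : ℕ} (h : π.IsBlock ε r s t) :
    (π (1 - ε) (π.lastLetter ε) : ℕ) = t - 1 := by
  have := h.pos (π.lastLetter ε)
  have := π.pos_lastLetter ε
  have := h.card
  have := h.right_pos
  have := h.left_pos
  omega

theorem IsBlock.pos_loser {π : CombData A} {ε : Fin 2} {r s t : ℕ} (h : π.IsBlock ε r s t) :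
    (π ε (π.lastLetter (1 - ε)) : ℕ) = r - 1 := by
  have := h.symm.pos_winner
  rwa [Fin.two_one_sub_one_sub] at this

/-- The loser is the last letter of `X` and is inserted just after `Z`, so it passes from the end of
`X` to the front of `Y`. If `X` consisted of the loser only, the new rows are `X' Z` and `Z X'`,
with `X'` the loser followed by `Y`, and the new middle block is empty. -/
theorem IsBlock.hasBlocks_rauzy {π : CombData A} {ε : Fin 2} {r s t : ℕ}
    (h : π.IsBlock ε r s t) : (rauzy ε π).HasBlocks := by
  have hc := h.card
  have hr := h.left_pos
  have ht := h.right_pos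
  have hw := h.pos_winner
  have key : ∀ α, (rauzy ε π (1 - ε) α : ℕ) =
      if (π (1 - ε) α : ℕ) ≤ t - 1 then (π (1 - ε) α : ℕ)
      else if (π (1 - ε) α : ℕ) = Fintype.card A - 1 then t
      else (π (1 - ε) α : ℕ) + 1 := by
    intro α
    rw [pos_rauzy_one_sub, hw, Nat.sub_add_cancel ht]
  rcases Nat.lt_or_ge 1 r with h1 | h1
  · refine IsBlock.hasBlocks (ε := ε) (r := r - 1) (s := s + 1) (t := t)
      ⟨by omega, ht, by omega, fun α => ?_⟩
    rw [rauzy_apply_self, key]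
    have := h.pos α
    split_ifs <;> omega
  · refine IsBlock.hasBlocks (ε := ε) (r := s + 1) (s := 0) (t := t)
      ⟨by omega, ht, by omega, fun α => ?_⟩
    rw [rauzy_apply_self, key]
    have := h.pos α
    split_ifs <;> omega

theorem hasBlocks_rauzy {π : CombData A} (h : π.HasBlocks) (ε : Fin 2) :
    (rauzy ε π).HasBlocks := by
  obtain ⟨r, s, t, h⟩ := h.exists_isBlock ε
  exact h.hasBlocks_rauzy

end Rauzy

end CombData

/-! ### The jump map, invariant under the cocycle -/

namespace CombData

variable {A : Type*} [Fintype A]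

/-- The letter preceding `β` in row `ε`. -/
def pred (π : CombData A) (ε : Fin 2) (β : A) : A :=
  (π ε).symm ⟨(π ε β : ℕ) - 1, lt_of_le_of_lt (Nat.sub_le _ _) (π ε β).isLt⟩

theorem pred_eq {π : CombData A} {ε : Fin 2} {α β : A} (h : (π ε α : ℕ) + 1 = π ε β) :
    π.pred ε β = α := by
  rw [pred, Equiv.symm_apply_eq]
  ext
  simp only
  omega

open Classical in
/-- The jumps of the piecewise constant function with values `v` at the marked points of the
circle, labelled by the letters that are not in the first place of a row. -/
noncomputable def jump (π : CombData A) : (A → ℝ) →ₗ[ℝ] (A → ℝ) where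
  toFun v β := if 0 < (π 0 β : ℕ) ∧ 0 < (π 1 β : ℕ) then
    v β - v (π.pred 0 β) - (if π.pred 0 β = π.pred 1 β then 0 else v (π.pred 1 β)) else 0
  map_add' v w := by
    ext β
    simp only [Pi.add_apply]
    split_ifs <;> ring
  map_smul' c v := by
    ext β
    simp only [Pi.smul_apply, smul_eq_mul, RingHom.id_apply]
    split_ifs <;> ring

theorem jump_of_pos_eq_zero {π : CombData A} {ε : Fin 2} {β : A} (h : (π ε β : ℕ) = 0)
    (v : A → ℝ) : π.jump v β = 0 := by
  refine if_neg ?_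
  rintro ⟨h0, h1⟩
  fin_cases ε <;> simp at h <;> omega

theorem jump_of_eq {π : CombData A} {ε : Fin 2} {α β : A} (h : (π ε α : ℕ) + 1 = π ε β)
    (h' : (π (1 - ε) α : ℕ) + 1 = π (1 - ε) β) (v : A → ℝ) : π.jump v β = v β - v α := by
  have key : (π 0 α : ℕ) + 1 = π 0 β ∧ (π 1 α : ℕ) + 1 = π 1 β := by
    fin_cases ε
    · exact ⟨h, h'⟩
    · exact ⟨h', h⟩
  obtain ⟨k0, k1⟩ := key
  refine (if_pos ⟨by omega, by omega⟩).trans ?_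
  rw [pred_eq k0, pred_eq k1, if_pos rfl, sub_zero]

theorem jump_of_ne {π : CombData A} {ε : Fin 2} {α α' β : A} (h : (π ε α : ℕ) + 1 = π ε β)
    (h' : (π (1 - ε) α' : ℕ) + 1 = π (1 - ε) β) (hne : α ≠ α') (v : A → ℝ) :
    π.jump v β = v β - v α - v α' := by
  fin_cases ε
  · replace h : (π 0 α : ℕ) + 1 = π 0 β := h
    replace h' : (π 1 α' : ℕ) + 1 = π 1 β := h'
    refine (if_pos ⟨by omega, by omega⟩).trans ?_
    rw [pred_eq h, pred_eq h', if_neg hne]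
  · replace h : (π 1 α : ℕ) + 1 = π 1 β := h
    replace h' : (π 0 α' : ℕ) + 1 = π 0 β := h'
    refine (if_pos ⟨by omega, by omega⟩).trans ?_
    rw [pred_eq h, pred_eq h', if_neg hne.symm]
    ring

theorem norm_jump_le (π : CombData A) (v : A → ℝ) : ‖π.jump v‖ ≤ 3 * ‖v‖ := by
  rw [pi_norm_le_iff_of_nonneg (by positivity)]
  intro β
  have h := fun α => abs_le.mp (norm_le_pi_norm v α)
  have h0 := norm_nonneg v
  have h1 := h β
  have h2 := h (π.pred 0 β)
  have h3 := h (π.pred 1 β)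
  rw [Real.norm_eq_abs, abs_le]
  change -(3 * ‖v‖) ≤ ite _ _ _ ∧ ite _ _ _ ≤ _
  split_ifs <;> constructor <;> linarith

section Rauzy

variable [Nontrivial A] [DecidableEq A]

theorem Theta_mulVec (π : CombData A) (ε : Fin 2) (v : A → ℝ) (α : A) :
    (π.Theta ε).mulVec v α =
      v α + if α = π.lastLetter (1 - ε) then v (π.lastLetter ε) else 0 := by
  rw [Theta, Matrix.add_mulVec, Matrix.one_mulVec, Pi.add_apply, Matrix.single_mulVec,
    one_mul, Function.update_apply]
  simp

/-- Only two jumps involve the loser `x`. When `x` becomes the first letter of `Y`, its new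
predecessor `z` is subtracted, which cancels the `v z` added by `Theta`. At the old first letter of
`Y`, subtracting `v x` and `v z` becomes subtracting the single new value `v x + v z`. -/
theorem HasBlocks.jump_Theta_mulVec {π : CombData A} (hπ : π.HasBlocks) (ε : Fin 2)
    (v : A → ℝ) : (rauzy ε π).jump ((π.Theta ε).mulVec v) = π.jump v := by
  obtain ⟨r, s, t, h⟩ := hπ.exists_isBlock ε
  have hc := h.card
  have hr := h.left_pos
  have ht := h.right_pos
  have hw := h.pos_winner
  have hl := h.pos_loser
  have hwl := π.pos_lastLetter ε
  have hll := π.pos_lastLetter (1 - ε)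
  set x := π.lastLetter (1 - ε) with hx
  set z := π.lastLetter ε with hz
  have hzx : z ≠ x := by
    intro e
    rw [e] at hwl
    omega
  have key : ∀ α, (rauzy ε π (1 - ε) α : ℕ) =
      if (π (1 - ε) α : ℕ) ≤ t - 1 then (π (1 - ε) α : ℕ)
      else if (π (1 - ε) α : ℕ) = Fintype.card A - 1 then t
      else (π (1 - ε) α : ℕ) + 1 := by
    intro α
    rw [pos_rauzy_one_sub, hw, Nat.sub_add_cancel ht]
  have key0 : ∀ α, (rauzy ε π ε α : ℕ) = π ε α := fun α => by rw [rauzy_apply_self]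
  have hΘ : ∀ α, α ≠ x → (π.Theta ε).mulVec v α = v α := fun α hα => by
    rw [Theta_mulVec, if_neg hα, add_zero]
  have hΘx : (π.Theta ε).mulVec v x = v x + v z := by
    rw [Theta_mulVec, if_pos rfl]
  ext β
  have hβ := h.pos β
  have hβlt := (π ε β).isLt
  by_cases h0 : (π ε β : ℕ) = 0
  · rw [jump_of_pos_eq_zero h0, jump_of_pos_eq_zero (ε := ε) (by rw [key0, h0])]
  by_cases h1 : (π (1 - ε) β : ℕ) = 0
  · rw [jump_of_pos_eq_zero h1, jump_of_pos_eq_zero (ε := 1 - ε) (by rw [key, h1]; simp)]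
  obtain ⟨α, hα⟩ := π.exists_pos_eq ε (i := (π ε β : ℕ) - 1) (by omega)
  have hα' := h.pos α
  by_cases hβx : β = x
  · rw [hβx] at hβ hβlt h0 h1 hα ⊢
    have hαx : α ≠ x := by rintro rfl; omega
    have hαz : α ≠ z := by rintro rfl; omega
    rw [jump_of_eq (π := π) (ε := ε) (α := α) (by omega) (by omega),
      jump_of_ne (ε := ε) (α := α) (α' := z) (by rw [key0, key0]; omega)
        (by rw [key, key]; split_ifs <;> omega) hαz, hΘx, hΘ α hαx, hΘ z hzx]
    ring
  have hβd : (π (1 - ε) β : ℕ) ≠ Fintype.card A - 1 := fun e =>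
    hβx (π.eq_of_pos_eq (1 - ε) (by omega))
  have hβd' := (π (1 - ε) β).isLt
  by_cases hβr : (π ε β : ℕ) = r
  · rw [jump_of_ne (π := π) (ε := ε) (α := x) (α' := z) (by omega) (by omega) hzx.symm,
      jump_of_eq (ε := ε) (α := x) (by rw [key0, key0]; omega)
        (by rw [key, key]; split_ifs <;> omega), hΘx, hΘ β hβx]
    ring
  · have hαx : α ≠ x := by rintro rfl; omega
    rw [jump_of_eq (π := π) (ε := ε) (α := α) (by omega) (by omega),
      jump_of_eq (ε := ε) (α := α) (by rw [key0, key0]; omega)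
        (by rw [key, key]; split_ifs <;> omega), hΘ β hβx, hΘ α hαx]

end Rauzy

/-! ### Vectors controlled by their jumps and two values -/

section Estimates

variable {π : CombData A} {ε : Fin 2} {r s t : ℕ}

/-- Inside `X` neighbours agree in both rows, so the difference telescopes into jumps. -/
theorem IsBlock.abs_sub_first_le (h : π.IsBlock ε r s t) {x : A} (hx : (π ε x : ℕ) = 0)
    (v : A → ℝ) {α : A} (hα : (π ε α : ℕ) < r) :
    |v α - v x| ≤ Fintype.card A * ‖π.jump v‖ := by
  have key : ∀ n, ∀ α, (π ε α : ℕ) = n → n < r → |v α - v x| ≤ n * ‖π.jump v‖ := by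
    intro n
    induction n with
    | zero =>
      intro α h0 _
      rw [π.eq_of_pos_eq ε (h0.trans hx.symm)]
      simp
    | succ n ih =>
      intro α h0 hn
      obtain ⟨β, hβ⟩ := π.exists_pos_eq ε (i := n) (by have := h.card; omega)
      have h1 := ih β hβ (by omega)
      have h2 := norm_le_pi_norm (π.jump v) α
      rw [jump_of_eq (ε := ε) (α := β) (by omega)
        (by have := h.pos α; have := h.pos β; omega), Real.norm_eq_abs] at h2
      push_cast
      calc |v α - v x| = |(v α - v β) + (v β - v x)| := by ring_nf
        _ ≤ |v α - v β| + |v β - v x| := abs_add_le _ _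
        _ ≤ _ := by linarith
  refine (key _ α rfl hα).trans ?_
  gcongr
  exact (π ε α).isLt.le

/-- Up to jumps, `v` equals `v x` on `X`, `v z` on `Z` and `v x + v z` on `Y`. -/
theorem IsBlock.norm_le [Nontrivial A] (h : π.IsBlock ε r s t) {x z : A} (hx : (π ε x : ℕ) = 0)
    (hz : (π (1 - ε) z : ℕ) = 0) (v : A → ℝ) :
    ‖v‖ ≤ |v x| + |v z| + 3 * (Fintype.card A * ‖π.jump v‖) := by
  have hc := h.card
  have hr := h.left_pos
  have ht := h.right_pos
  have hw := h.pos_winner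
  have hl := h.pos_loser
  have hwl := π.pos_lastLetter ε
  set x' := π.lastLetter (1 - ε)
  set z' := π.lastLetter ε
  have hxz' : x' ≠ z' := by intro e; rw [e] at hl; omega
  have hx' := abs_le.mp (h.abs_sub_first_le hx v (α := x') (by omega))
  have hz' := abs_le.mp (h.symm.abs_sub_first_le hz v (α := z') (by omega))
  have hJ : (0 : ℝ) ≤ Fintype.card A * ‖π.jump v‖ := by positivity
  have a1 := le_abs_self (v x)
  have a2 := neg_abs_le (v x)
  have a3 := le_abs_self (v z)
  have a4 := neg_abs_le (v z)
  have key : ∀ n, ∀ α, (π ε α : ℕ) = r + n → n < s →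
      |v α - v x' - v z'| ≤ (n + 1) * ‖π.jump v‖ := by
    intro n
    induction n with
    | zero =>
      intro α h0 hs
      have h2 := norm_le_pi_norm (π.jump v) α
      rw [jump_of_ne (ε := ε) (α := x') (α' := z') (by omega)
        (by have := h.pos α; omega) hxz', Real.norm_eq_abs] at h2
      simpa using h2
    | succ n ih =>
      intro α h0 hn
      obtain ⟨β, hβ⟩ := π.exists_pos_eq ε (i := r + n) (by omega)
      have h1 := ih β hβ (by omega)
      have h2 := norm_le_pi_norm (π.jump v) α
      rw [jump_of_eq (ε := ε) (α := β) (by omega)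
        (by have := h.pos α; have := h.pos β; omega), Real.norm_eq_abs] at h2
      push_cast
      calc |v α - v x' - v z'| = |(v α - v β) + (v β - v x' - v z')| := by ring_nf
        _ ≤ |v α - v β| + |v β - v x' - v z'| := abs_add_le _ _
        _ ≤ _ := by linarith
  rw [pi_norm_le_iff_of_nonneg (by positivity)]
  intro α
  rw [Real.norm_eq_abs, abs_le]
  rcases lt_or_ge (π ε α : ℕ) r with h1 | h1
  · have := abs_le.mp (h.abs_sub_first_le hx v h1)
    constructor <;> linarith
  rcases lt_or_ge (π ε α : ℕ) (r + s) with h2 | h2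
  · have h3 := key (π ε α - r) α (by omega) (by omega)
    have h4 : |v α - v x' - v z'| ≤ Fintype.card A * ‖π.jump v‖ := by
      refine h3.trans ?_
      gcongr
      exact_mod_cast (by omega : (π ε α : ℕ) - r + 1 ≤ Fintype.card A)
    have := abs_le.mp h4
    constructor <;> linarith
  · have := abs_le.mp (h.symm.abs_sub_first_le hz v (α := α)
      (by have := h.pos α; have := (π ε α).isLt; omega))
    constructor <;> linarith

end Estimates

/-! ### Image and kernel of `Ω_π` -/

section Kernel

variable {π : CombData A}

theorem Omega_transpose (π : CombData A) : π.Omega.transpose = -π.Omega := by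
  ext α β
  simp only [Matrix.transpose_apply, Matrix.neg_apply, Omega]
  split_ifs <;> first | (exfalso; omega) | simp

/-- Vectors constant on the blocks `X`, `Y`, `Z`, whose value on `Y` is the sum of the
values on `X` and `Z`, have no jumps. -/
theorem IsBlock.jump_eq_zero [Nontrivial A] {r s t : ℕ} (h : π.IsBlock 0 r s t)
    {v : A → ℝ} {a b : ℝ}
    (hv : ∀ α, v α = if (π 0 α : ℕ) < r then a else if (π 0 α : ℕ) < r + s then a + b else b) :
    π.jump v = 0 := by
  have hr := h.left_pos
  have ht := h.right_pos
  have hc := h.card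
  have hw := h.pos_winner
  have hl := h.pos_loser
  have hwl := π.pos_lastLetter 0
  ext β
  have hβ := h.pos β
  have hβlt := (π 0 β).isLt
  by_cases h0 : (π 0 β : ℕ) = 0
  · rw [jump_of_pos_eq_zero h0]; rfl
  by_cases h1 : (π (1 - 0) β : ℕ) = 0
  · rw [jump_of_pos_eq_zero h1]; rfl
  by_cases hβr : (π 0 β : ℕ) = r
  · rw [jump_of_ne (ε := 0) (α := π.lastLetter (1 - 0)) (α' := π.lastLetter 0) (by omega)
      (by omega) (by intro e; rw [e] at hl; omega), hv, hv, hv, if_neg (by omega),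
      if_pos (by omega), if_pos (by omega), if_neg (by omega), if_neg (by omega)]
    simp
  · obtain ⟨α, hα⟩ := π.exists_pos_eq 0 (i := (π 0 β : ℕ) - 1) (by omega)
    have hα' := h.pos α
    rw [jump_of_eq (ε := 0) (α := α) (by omega) (by omega), hv, hv]
    split_ifs <;> first | (exfalso; omega) | simp

/-- Each column of `Ω_π` is constant on the blocks and additive on `Y`. Conversely, the columns of
the first letters `z` and `x` are `(1, 1, 0)` and `(0, -1, -1)` on `X`, `Y`, `Z`. They combine to a
jump-free vector with prescribed values at `x` and `z`, and `IsBlock.norm_le` shows that there is no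
other. -/
theorem HasBlocks.imOmega_eq_ker_jump [Nontrivial A] (hπ : π.HasBlocks) :
    π.imOmega = LinearMap.ker π.jump := by
  classical
  obtain ⟨r, s, t, h⟩ := hπ
  have hr := h.left_pos
  have ht := h.right_pos
  have hc := h.card
  have h01 : (1 : Fin 2) - 0 = 1 := rfl
  have hpos := h.pos
  rw [h01] at hpos
  apply le_antisymm
  · rw [imOmega, Matrix.range_mulVecLin, Submodule.span_le]
    rintro _ ⟨γ, rfl⟩
    have hγ := hpos γ
    change π.jump (π.Omega.col γ) = 0
    refine h.jump_eq_zero (a := if (π 0 γ : ℕ) < r then 0 else 1)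
      (b := if (π 0 γ : ℕ) < r + s then -1 else 0) fun α => ?_
    have hα := hpos α
    have := (π 0 α).isLt
    have := (π 0 γ).isLt
    change π.Omega α γ = _
    simp only [Omega, Fin.lt_def]
    split_ifs <;> first | (exfalso; omega) | norm_num
  · intro v hv
    obtain ⟨x, hx⟩ := π.exists_pos_eq 0 (i := 0) (by omega)
    obtain ⟨z, hz⟩ := π.exists_pos_eq 1 (i := 0) (by omega)
    have hxp := hpos x
    have hzp := hpos z
    have hzlt := (π 0 z).isLt
    refine ⟨Pi.single z (v x) - Pi.single x (v z), ?_⟩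
    rw [map_sub, Matrix.mulVecLin_apply, Matrix.mulVecLin_apply, Matrix.mulVec_single,
      Matrix.mulVec_single]
    set w : A → ℝ := MulOpposite.op (v x) • π.Omega.col z - MulOpposite.op (v z) • π.Omega.col x
      with hw
    have hwv : ∀ α, w α = if (π 0 α : ℕ) < r then v x
        else if (π 0 α : ℕ) < r + s then v x + v z else v z := by
      intro α
      have hα := hpos α
      have := (π 0 α).isLt
      change π.Omega α z * v x - π.Omega α x * v z = _
      simp only [Omega, Fin.lt_def]
      split_ifs <;> first | (exfalso; omega) | simp
    have hJw : π.jump w = 0 := h.jump_eq_zero hwv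
    have hJ : π.jump (w - v) = 0 := by rw [map_sub, hJw, LinearMap.mem_ker.mp hv, sub_zero]
    have hle := h.norm_le (v := w - v) hx hz
    rw [hJ, Pi.sub_apply, Pi.sub_apply, hwv, hwv, if_pos (by omega), if_neg (by omega),
      if_neg (by omega)] at hle
    simp only [sub_self, abs_zero, norm_zero, mul_zero, add_zero] at hle
    exact sub_eq_zero.mp (norm_le_zero_iff.mp hle)

/-- For an antisymmetric matrix, kernel and image are orthogonal. -/
theorem disjoint_kerOmega_imOmega (π : CombData A) : Disjoint π.kerOmega π.imOmega := by
  rw [Submodule.disjoint_def]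
  rintro _ hv ⟨l, rfl⟩
  simp only [LinearMap.mem_ker, Matrix.mulVecLin_apply] at hv ⊢
  have h1 : dotProduct (π.Omega.mulVec l) (π.Omega.mulVec l) = 0 := by
    rw [Matrix.dotProduct_mulVec, ← Matrix.mulVec_transpose, Omega_transpose, Matrix.neg_mulVec,
      hv, neg_zero, zero_dotProduct]
  exact dotProduct_self_eq_zero.mp h1

theorem isCompl_kerOmega_imOmega (π : CombData A) : IsCompl π.kerOmega π.imOmega := by
  refine ⟨π.disjoint_kerOmega_imOmega, ?_⟩
  rw [codisjoint_iff]
  apply Submodule.eq_top_of_finrank_eq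
  have h1 := Submodule.finrank_sup_add_finrank_inf_eq π.kerOmega π.imOmega
  rw [π.disjoint_kerOmega_imOmega.eq_bot, finrank_bot] at h1
  have h2 := LinearMap.finrank_range_add_finrank_ker π.Omega.mulVecLin
  change Module.finrank ℝ π.imOmega + Module.finrank ℝ π.kerOmega = _ at h2
  omega

/-- Evaluation at the first letters of the two rows identifies `Im Ω_π` with `ℝ²`. -/
theorem HasBlocks.finrank_kerOmega [Nontrivial A] (hπ : π.HasBlocks) :
    Module.finrank ℝ π.kerOmega = Fintype.card A - 2 := by
  classical
  have h2 := LinearMap.finrank_range_add_finrank_ker π.Omega.mulVecLin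
  change Module.finrank ℝ π.imOmega + Module.finrank ℝ π.kerOmega = _ at h2
  rw [Module.finrank_fintype_fun_eq_card] at h2
  have him := hπ.imOmega_eq_ker_jump
  obtain ⟨r, s, t, h⟩ := hπ
  have hr := h.left_pos
  have ht := h.right_pos
  have hc := h.card
  obtain ⟨x, hx⟩ := π.exists_pos_eq 0 (i := 0) (by omega)
  obtain ⟨z, hz⟩ := π.exists_pos_eq 1 (i := 0) (by omega)
  have hxp := h.pos x
  have hzp := h.pos z
  have hzlt := (π 0 z).isLt
  have h01 : (1 : Fin 2) - 0 = 1 := rfl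
  rw [h01] at hzp
  let e : (A → ℝ) →ₗ[ℝ] ℝ × ℝ := (LinearMap.proj x).prod (LinearMap.proj z)
  have hinj : Function.Injective (e ∘ₗ π.imOmega.subtype) := by
    rw [← LinearMap.ker_eq_bot, LinearMap.ker_eq_bot']
    rintro ⟨v, hv⟩ he
    rw [him] at hv
    have h1 : v x = 0 := congrArg Prod.fst he
    have h2 : v z = 0 := congrArg Prod.snd he
    have hle := h.norm_le hx hz v
    rw [h1, h2, LinearMap.mem_ker.mp hv] at hle
    simp only [abs_zero, norm_zero, mul_zero, add_zero] at hle
    exact Subtype.ext (norm_le_zero_iff.mp hle)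
  have hsurj : Function.Surjective (e ∘ₗ π.imOmega.subtype) := by
    rintro ⟨a, b⟩
    refine ⟨⟨fun α => if (π 0 α : ℕ) < r then a else if (π 0 α : ℕ) < r + s then a + b else b,
      ?_⟩, ?_⟩
    · rw [him]
      exact h.jump_eq_zero fun α => rfl
    · refine Prod.ext ?_ ?_
      · exact if_pos (by omega)
      · exact (if_neg (by omega)).trans (if_neg (by omega))
  have h3 := (LinearEquiv.ofBijective _ ⟨hinj, hsurj⟩).finrank_eq
  rw [Module.finrank_prod, Module.finrank_self] at h3
  omega

end Kernel

end CombData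

/-! ### Periodic orbits of the additive Euclid algorithm with errors -/

section PeriodicSequences

/-- One step of the additive Euclid algorithm on pairs, with an error at most `U`. -/
def EuclidStep (U : ℝ) (a b a' b' : ℝ) : Prop :=
  (|a' - a - b| ≤ U ∧ b' = b) ∨ (a' = a ∧ |b' - b - a| ≤ U) ∨ (a' = a ∧ b' = b)

variable {a b : ℕ → ℝ} {U : ℝ} {p : ℕ}

theorem EuclidStep.neg {x y x' y' : ℝ} (h : EuclidStep U x y x' y') :
    EuclidStep U (-x) (-y) (-x') (-y') := by
  rcases h with ⟨h1, h2⟩ | ⟨h1, h2⟩ | ⟨h1, h2⟩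
  · exact Or.inl ⟨by rw [← abs_neg]; convert h1 using 2; ring, by rw [h2]⟩
  · exact Or.inr (Or.inl ⟨by rw [h1], by rw [← abs_neg]; convert h2 using 2; ring⟩)
  · exact Or.inr (Or.inr ⟨by rw [h1], by rw [h2]⟩)

theorem periodic_add_mul (ha : ∀ i, a (i + p) = a i) (m i : ℕ) : a (i + p * m) = a i := by
  induction m with
  | zero => simp
  | succ m ih => rw [Nat.mul_succ, ← add_assoc, ha, ih]

/-- The region is forward invariant and `a` is nondecreasing there. The step at `e` increases `a`
strictly, which contradicts periodicity. -/
theorem not_both_gt_of_periodic (hp : 0 < p) (ha : ∀ i, a (i + p) = a i)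
    (hb : ∀ i, b (i + p) = b i) (hs : ∀ i, EuclidStep U (a i) (b i) (a (i + 1)) (b (i + 1)))
    {e : ℕ} (he : |a (e + 1) - a e - b e| ≤ U) (i : ℕ) : ¬ (U < a i ∧ U < b i) := by
  intro hi
  have step : ∀ j, U < a j ∧ U < b j →
      (U < a (j + 1) ∧ U < b (j + 1)) ∧ a j ≤ a (j + 1) := by
    intro j ⟨h1, h2⟩
    rcases hs j with ⟨h3, h4⟩ | ⟨h3, h4⟩ | ⟨h3, h4⟩
    · rw [abs_le] at h3
      refine ⟨⟨?_, ?_⟩, ?_⟩ <;> linarith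
    · rw [abs_le] at h4
      refine ⟨⟨?_, ?_⟩, ?_⟩ <;> linarith
    · refine ⟨⟨?_, ?_⟩, ?_⟩ <;> linarith
  have hge : ∀ m, U < a (i + m) ∧ U < b (i + m) := by
    intro m
    induction m with
    | zero => exact hi
    | succ m ih => exact (step _ ih).1
  -- Periodicity carries the property from the times after `i` to all times.
  have hall : ∀ j, U < a j ∧ U < b j := by
    intro j
    have h := hge (j + p * i - i)
    have : i ≤ p * i := Nat.le_mul_of_pos_left i hp
    rw [show i + (j + p * i - i) = j + p * i by omega, periodic_add_mul ha,
      periodic_add_mul hb] at h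
    exact h
  have hmono : Monotone a := monotone_nat_of_le_succ fun j => (step j (hall j)).2
  have h1 : a (e + 1) ≤ a (e + p) := hmono (by omega)
  rw [ha] at h1
  rw [abs_le] at he
  have := (hall e).2
  linarith

/-- The time-reversed argument: undoing a step subtracts values of opposite sign, so the region is
backward invariant and `a` grows backwards. -/
theorem not_gt_and_lt_of_periodic (hp : 0 < p) (ha : ∀ i, a (i + p) = a i)
    (hb : ∀ i, b (i + p) = b i) (hs : ∀ i, EuclidStep U (a i) (b i) (a (i + 1)) (b (i + 1)))
    {e : ℕ} (he : |a (e + 1) - a e - b e| ≤ U) (i : ℕ) : ¬ (U < a i ∧ b i < -U) := by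
  intro hi
  have step : ∀ j, U < a (j + 1) ∧ b (j + 1) < -U →
      (U < a j ∧ b j < -U) ∧ a (j + 1) ≤ a j := by
    intro j ⟨h1, h2⟩
    rcases hs j with ⟨h3, h4⟩ | ⟨h3, h4⟩ | ⟨h3, h4⟩
    · rw [abs_le] at h3
      refine ⟨⟨?_, ?_⟩, ?_⟩ <;> linarith
    · rw [abs_le] at h4
      refine ⟨⟨?_, ?_⟩, ?_⟩ <;> linarith
    · refine ⟨⟨?_, ?_⟩, ?_⟩ <;> linarith
  have hle : ∀ m j, U < a (j + m) ∧ b (j + m) < -U → U < a j ∧ b j < -U := by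
    intro m
    induction m with
    | zero => intro j h; exact h
    | succ m ih => intro j h; exact ih j (step (j + m) h).1
  have hall : ∀ j, U < a j ∧ b j < -U := by
    intro j
    apply hle (i + p * j - j) j
    have : j ≤ p * j := Nat.le_mul_of_pos_left j hp
    rw [show j + (i + p * j - j) = i + p * j by omega, periodic_add_mul ha,
      periodic_add_mul hb]
    exact hi
  have hanti : Antitone a := antitone_nat_of_succ_le fun j => (step j (hall (j + 1))).2
  have h1 : a (e + p) ≤ a (e + 1) := hanti (by omega)
  rw [ha] at h1
  rw [abs_le] at he
  have := (hall e).2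
  linarith

theorem abs_le_or_abs_le_of_periodic (hp : 0 < p) (ha : ∀ i, a (i + p) = a i)
    (hb : ∀ i, b (i + p) = b i) (hs : ∀ i, EuclidStep U (a i) (b i) (a (i + 1)) (b (i + 1)))
    {e : ℕ} (he : |a (e + 1) - a e - b e| ≤ U) (i : ℕ) : |a i| ≤ U ∨ |b i| ≤ U := by
  have ha' : ∀ i, (-a) (i + p) = (-a) i := fun i => by simp [ha]
  have hb' : ∀ i, (-b) (i + p) = (-b) i := fun i => by simp [hb]
  have he' : |(-a) (e + 1) - (-a) e - (-b) e| ≤ U := by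
    rw [← abs_neg]; convert he using 2; simp only [Pi.neg_apply]; ring
  have h1 := not_both_gt_of_periodic hp ha hb hs he i
  have h2 := not_both_gt_of_periodic hp ha' hb' (fun i => (hs i).neg) he' i
  have h3 := not_gt_and_lt_of_periodic hp ha hb hs he i
  have h4 := not_gt_and_lt_of_periodic hp ha' hb' (fun i => (hs i).neg) he' i
  simp only [Pi.neg_apply] at h2 h4
  by_contra hcon
  push Not at hcon
  rcases lt_abs.mp hcon.1 with h5 | h5 <;> rcases lt_abs.mp hcon.2 with h6 | h6
  · exact h1 ⟨h5, h6⟩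
  · exact h3 ⟨h5, by linarith⟩
  · exact h4 ⟨h5, by linarith⟩
  · exact h2 ⟨h5, h6⟩

/-- If `|b i| > U`, then `a` is at most `U` in size both before and after the step, and `b i` is the
difference up to an error `U`. -/
theorem abs_le_three_mul_of_periodic (hp : 0 < p) (ha : ∀ i, a (i + p) = a i)
    (hb : ∀ i, b (i + p) = b i) (hs : ∀ i, EuclidStep U (a i) (b i) (a (i + 1)) (b (i + 1)))
    {i : ℕ} (hi : |a (i + 1) - a i - b i| ≤ U) (hbi : b (i + 1) = b i) : |b i| ≤ 3 * U := by
  have hU : 0 ≤ U := (abs_nonneg _).trans hi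
  have h1 := abs_le_or_abs_le_of_periodic hp ha hb hs hi i
  have h2 := abs_le_or_abs_le_of_periodic hp ha hb hs hi (i + 1)
  rw [hbi] at h2
  simp only [abs_le] at *
  rcases h1 with h1 | h1
  · rcases h2 with h2 | h2 <;> constructor <;> linarith
  · constructor <;> linarith

theorem EuclidStep.symm {x y x' y' : ℝ} (h : EuclidStep U x y x' y') :
    EuclidStep U y x y' x' := by
  rcases h with ⟨h1, h2⟩ | ⟨h1, h2⟩ | h
  · exact Or.inr (Or.inl ⟨h2, h1⟩)
  · exact Or.inl ⟨h2, h1⟩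
  · exact Or.inr (Or.inr h.symm)

/-- A periodic orbit of the additive Euclid algorithm with bounded errors is bounded at every
time that is followed by steps of both kinds within a bounded time. -/
theorem abs_le_of_periodic {EA EB : ℕ → Prop} (hp : 0 < p) (ha : ∀ i, a (i + p) = a i)
    (hb : ∀ i, b (i + p) = b i)
    (hA : ∀ i, EA i → |a (i + 1) - a i - b i| ≤ U ∧ b (i + 1) = b i)
    (hB : ∀ i, EB i → a (i + 1) = a i ∧ |b (i + 1) - b i - a i| ≤ U)
    (hN : ∀ i, ¬ EA i → ¬ EB i → a (i + 1) = a i ∧ b (i + 1) = b i)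
    {K : ℕ} (hEA : ∃ i ≤ K, EA i) (hEB : ∃ i ≤ K, EB i) :
    |a 0| ≤ (3 + 4 * K) * U ∧ |b 0| ≤ (3 + 4 * K) * U := by
  classical
  have hs : ∀ i, EuclidStep U (a i) (b i) (a (i + 1)) (b (i + 1)) := fun i => by
    by_cases h1 : EA i
    · exact Or.inl (hA i h1)
    · by_cases h2 : EB i
      · exact Or.inr (Or.inl (hB i h2))
      · exact Or.inr (Or.inr (hN i h1 h2))
  have main : ∀ (a b : ℕ → ℝ) (EA EB : ℕ → Prop), (∀ i, a (i + p) = a i) →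
      (∀ i, b (i + p) = b i) →
      (∀ i, EA i → |a (i + 1) - a i - b i| ≤ U ∧ b (i + 1) = b i) →
      (∀ i, EB i → a (i + 1) = a i ∧ |b (i + 1) - b i - a i| ≤ U) →
      (∀ i, ¬ EA i → ¬ EB i → a (i + 1) = a i ∧ b (i + 1) = b i) →
      (∀ i, EuclidStep U (a i) (b i) (a (i + 1)) (b (i + 1))) →
      ∀ i j, j ≤ K → EA i → EB j → (∀ m < j, ¬ EB m) → i ≤ j →
      |a 0| ≤ (3 + 4 * K) * U ∧ |b 0| ≤ (3 + 4 * K) * U := by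
    intro a b EA EB ha hb hA hB hN hs i j hjK hi hj hmin hij
    have hU : 0 ≤ U := (abs_nonneg _).trans (hA i hi).1
    have h1 := abs_le_three_mul_of_periodic hp ha hb hs (hA i hi).1 (hA i hi).2
    have h2 := abs_le_three_mul_of_periodic hp hb ha (fun i => (hs i).symm) (hB j hj).2
      (hB j hj).1
    -- Before the first `EB` step `b` is frozen, so the bound at time `i` holds at time `0`. Each
    -- step then moves `a` by at most `3U + U`, and the bound on `a j` is carried back over `j ≤ K`
    -- steps.
    have hbc : ∀ m ≤ j, b m = b 0 := by
      intro m
      induction m with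
      | zero => intro _; rfl
      | succ m ih =>
        intro hm
        rw [← ih (by omega)]
        by_cases h : EA m
        · exact (hA m h).2
        · exact (hN m h (hmin m (by omega))).2
    rw [hbc i hij] at h1
    have hac : ∀ m ≤ j, |a m - a 0| ≤ 4 * m * U := by
      intro m
      induction m with
      | zero => intro _; simp
      | succ m ih =>
        intro hm
        have h3 := abs_le.mp (ih (by omega))
        have h4 := abs_le.mp h1
        push_cast
        rw [abs_le]
        by_cases h : EA m
        · have h5 := abs_le.mp (hA m h).1
          rw [hbc m (by omega)] at h5
          constructor <;> linarith
        · rw [(hN m h (hmin m (by omega))).1]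
          constructor <;> linarith
    have h3 := abs_le.mp (hac j le_rfl)
    have h4 : (j : ℝ) * U ≤ K * U := by gcongr
    have h5 : 0 ≤ (K : ℝ) * U := by positivity
    have h2' := abs_le.mp h2
    have h1' := abs_le.mp h1
    simp only [abs_le]
    refine ⟨⟨?_, ?_⟩, ?_, ?_⟩ <;> linarith
  obtain ⟨i₀, hi₀, hi₀'⟩ := hEA
  obtain ⟨j₀, hj₀, hj₀'⟩ := hEB
  have hAex : ∃ i, EA i := ⟨_, hi₀'⟩
  have hBex : ∃ i, EB i := ⟨_, hj₀'⟩
  rcases le_total (Nat.find hAex) (Nat.find hBex) with h | h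
  · exact main a b EA EB ha hb hA hB hN hs _ _ ((Nat.find_min' hBex hj₀').trans hj₀)
      (Nat.find_spec hAex) (Nat.find_spec hBex) (fun m hm => Nat.find_min hBex hm) h
  · exact (main b a EB EA hb ha (fun i h => (hB i h).symm) (fun i h => (hA i h).symm)
      (fun i h1 h2 => (hN i h2 h1).symm) (fun i => (hs i).symm) _ _
      ((Nat.find_min' hAex hi₀').trans hi₀)
      (Nat.find_spec hBex) (Nat.find_spec hAex) (fun m hm => Nat.find_min hAex hm) h).symm

end PeriodicSequences

/-! ### Vectors fixed by a period of an admissible sequence -/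

namespace CombSeq

open CombData

variable {A : Type*} [Fintype A] [Nontrivial A] {γ : CombSeq A}

theorem Admissible.hasBlocks (hγ : γ.Admissible) (h0 : (γ 0).1.HasBlocks) (n : ℕ) :
    (γ n).1.HasBlocks := by
  induction n with
  | zero => exact h0
  | succ n ih => rw [hγ n]; exact hasBlocks_rauzy ih _

theorem Admissible.pos_eq_zero (hγ : γ.Admissible) {ε : Fin 2} {x : A}
    (hx : ((γ 0).1 ε x : ℕ) = 0) (n : ℕ) : ((γ n).1 ε x : ℕ) = 0 := by
  induction n with
  | zero => exact hx
  | succ n ih => rw [hγ n]; exact pos_rauzy_eq_zero ih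

/-- The window of radius `k` is centred at `j + k` so that it lies after `j`. -/
theorem KBounded.exists_loser {k : ℕ} (hk : γ.KBounded k) (j : ℕ) (δ : A) :
    ∃ i ≤ 2 * k, γ.letter (j + i) (1 - (γ (j + i)).2) = δ := by
  obtain ⟨n₁, p, h1, h2, -, h4, -⟩ := hk (j + k) δ δ
  rw [abs_lt] at h2
  refine ⟨n₁ + p - j, by omega, ?_⟩
  rw [show j + (n₁ + p - j) = n₁ + p by omega, h4]

variable [DecidableEq A]

theorem cocycle_succ (γ : CombSeq A) (j m : ℕ) :
    γ.cocycle j (m + 1) = γ.theta (j + m) * γ.cocycle j m := rfl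

theorem cocycle_add (γ : CombSeq A) (j m p : ℕ) :
    γ.cocycle j (m + p) = γ.cocycle (j + m) p * γ.cocycle j m := by
  induction p with
  | zero => simp [cocycle]
  | succ p ih => rw [← add_assoc, cocycle_succ, ih, cocycle_succ, Matrix.mul_assoc, add_assoc j m]

theorem cocycle_congr {γ γ' : CombSeq A} {j m : ℕ} (h : ∀ i < m, γ (j + i) = γ' (j + i)) :
    γ.cocycle j m = γ'.cocycle j m := by
  induction m with
  | zero => rfl
  | succ m ih =>
    rw [cocycle_succ, cocycle_succ, ih fun i hi => h i (by omega), theta, theta,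
      h m (by omega)]

theorem Admissible.jump_cocycle (hγ : γ.Admissible) (h0 : (γ 0).1.HasBlocks) (j m : ℕ)
    (v : A → ℝ) : (γ (j + m)).1.jump ((γ.cocycle j m).mulVec v) = (γ j).1.jump v := by
  induction m with
  | zero => simp [cocycle]
  | succ m ih =>
    rw [cocycle_succ, ← Matrix.mulVec_mulVec, ← add_assoc, hγ (j + m), theta,
      (hγ.hasBlocks h0 (j + m)).jump_Theta_mulVec, ih]

theorem cocycle_add_period {p : ℕ} (hper : ∀ i, γ (i + p) = γ i) {j : ℕ} {v : A → ℝ}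
    (hv : (γ.cocycle j p).mulVec v = v) (i : ℕ) :
    (γ.cocycle j (i + p)).mulVec v = (γ.cocycle j i).mulVec v := by
  induction i with
  | zero => rw [zero_add, hv]; simp [cocycle]
  | succ i ih =>
    rw [show i + 1 + p = i + p + 1 by ring, cocycle_succ, ← Matrix.mulVec_mulVec, ih,
      cocycle_succ, ← Matrix.mulVec_mulVec, theta, theta, ← add_assoc, hper]

/-- A vector fixed by a period of a periodic sequence is controlled by its jumps at every time
that is followed within a bounded time by losses of the first letters of both rows. -/
theorem Admissible.norm_le_of_fixed (hγ : γ.Admissible) (h0 : (γ 0).1.HasBlocks) {p : ℕ}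
    (hp : 0 < p) (hper : ∀ i, γ (i + p) = γ i) {j K : ℕ}
    (hK : ∀ δ : A, ∃ i ≤ K, γ.letter (j + i) (1 - (γ (j + i)).2) = δ) {v : A → ℝ}
    (hv : (γ.cocycle j p).mulVec v = v) :
    ‖v‖ ≤ (9 + 8 * K) * Fintype.card A * ‖(γ j).1.jump v‖ := by
  have hd : 2 ≤ Fintype.card A := Fintype.one_lt_card
  obtain ⟨x, hx0⟩ := (γ 0).1.exists_pos_eq 0 (i := 0) (by omega)
  obtain ⟨z, hz0⟩ := (γ 0).1.exists_pos_eq 1 (i := 0) (by omega)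
  have hx := hγ.pos_eq_zero hx0
  have hz := hγ.pos_eq_zero hz0
  let w : ℕ → A → ℝ := fun i => (γ.cocycle j i).mulVec v
  have hw : ∀ i α, w (i + 1) α = w i α + if α = γ.letter (j + i) (1 - (γ (j + i)).2) then
      w i (γ.letter (j + i) (γ (j + i)).2) else 0 := by
    intro i α
    simp only [w]
    rw [cocycle_succ, ← Matrix.mulVec_mulVec, theta, Theta_mulVec]
    rfl
  have hJ : ∀ i, (γ (j + i)).1.jump (w i) = (γ j).1.jump v := fun i =>
    hγ.jump_cocycle h0 j i v
  have hwp : ∀ i, w (i + p) = w i := fun i => cocycle_add_period hper hv i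
  have hxz : x ≠ z := by
    rintro rfl
    obtain ⟨r, s, t, h⟩ := h0
    have h1 := h.pos x
    have h2 : ((γ 0).1 (1 - 0) x : ℕ) = 0 := hz0
    have := h.left_pos
    have := h.right_pos
    omega
  have hlast : ∀ i ε, ((γ i).1 ε (γ.letter i ε) : ℕ) = Fintype.card A - 1 := fun i ε =>
    pos_lastLetter _ _
  have hbound : ∀ i ε y, ((γ i).1 (1 - ε) y : ℕ) = 0 → ∀ u : A → ℝ,
      |u (γ.letter i ε) - u y| ≤ Fintype.card A * ‖(γ i).1.jump u‖ := by
    intro i ε y hy u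
    obtain ⟨r, s, t, h⟩ := (hγ.hasBlocks h0 i).exists_isBlock ε
    have h1 := h.pos_winner
    have h2 := h.right_pos
    refine h.symm.abs_sub_first_le hy u ?_
    change ((γ i).1 (1 - ε) ((γ i).1.lastLetter ε) : ℕ) < t
    omega
  -- When `x` loses, the winner lies in the block of `z`, so the amount added to `w i x` is `w i z`
  -- up to `U`; symmetrically when `z` loses.
  have hmain := abs_le_of_periodic (a := fun i => w i x) (b := fun i => w i z) (p := p)
    (U := Fintype.card A * ‖(γ j).1.jump v‖)
    (EA := fun i => γ.letter (j + i) (1 - (γ (j + i)).2) = x)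
    (EB := fun i => γ.letter (j + i) (1 - (γ (j + i)).2) = z) hp
    (fun i => by simp only [hwp]) (fun i => by simp only [hwp])
    (by
      intro i hi
      -- The first letter of row `0` cannot also be last there, so `x` loses only in steps of type
      -- `0`.
      have hε : (γ (j + i)).2 = 0 := by
        by_contra hne
        have h1 := hlast (j + i) 0
        have h2 := Fin.two_eq_one_sub_of_ne hne
        rw [h2] at hi
        change γ.letter (j + i) 0 = x at hi
        rw [hi, hx] at h1
        omega
      have hb := hbound (j + i) 0 z (hz (j + i)) (w i)
      rw [hJ] at hb
      rw [hw, hw, hi, if_pos rfl, if_neg hxz.symm, add_zero, hε]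
      refine ⟨?_, rfl⟩
      convert hb using 2
      ring)
    (by
      intro i hi
      have hε : (γ (j + i)).2 = 1 := by
        by_contra hne
        have h1 := hlast (j + i) 1
        have h2 := Fin.two_eq_one_sub_of_ne hne
        rw [h2] at hi
        change γ.letter (j + i) 1 = z at hi
        rw [hi, hz] at h1
        omega
      have hb := hbound (j + i) 1 x (hx (j + i)) (w i)
      rw [hJ] at hb
      rw [hw, hw, hi, if_pos rfl, if_neg hxz, add_zero, hε]
      refine ⟨rfl, ?_⟩
      convert hb using 2
      ring)
    (by
      intro i h1 h2
      simp only [hw, if_neg (Ne.symm h1), if_neg (Ne.symm h2), add_zero, and_self])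
    (hK x) (hK z)
  have hw0 : w 0 = v := by simp [w, cocycle]
  simp only [hw0] at hmain
  obtain ⟨r, s, t, h⟩ := hγ.hasBlocks h0 j
  have hle := h.norm_le (hx j) (hz j) v
  linarith [hmain.1, hmain.2]

end CombSeq

/-! ### Comparison of the sup norm with the Euclidean norm -/

theorem norm_le_norm_toLp {ι : Type*} [Fintype ι] (v : ι → ℝ) : ‖v‖ ≤ ‖WithLp.toLp 2 v‖ := by
  rw [pi_norm_le_iff_of_nonneg (norm_nonneg _)]
  exact fun i => PiLp.norm_apply_le (WithLp.toLp 2 v) i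

theorem norm_toLp_le {ι : Type*} [Fintype ι] (v : ι → ℝ) :
    ‖WithLp.toLp 2 v‖ ≤ Fintype.card ι * ‖v‖ := by
  rw [EuclideanSpace.norm_eq, Real.sqrt_le_iff]
  refine ⟨by positivity, ?_⟩
  calc ∑ i, ‖v i‖ ^ 2 ≤ ∑ _i : ι, ‖v‖ ^ 2 := by
        gcongr with i
        exact norm_le_pi_norm v i
    _ = Fintype.card ι * ‖v‖ ^ 2 := by simp
    _ ≤ (Fintype.card ι : ℝ) ^ 2 * ‖v‖ ^ 2 := by
        gcongr
        exact_mod_cast Nat.le_self_pow two_ne_zero _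
    _ = _ := by ring

/-! ### Central maps and their graphs -/

namespace CombData

variable {A : Type*} [Fintype A]

/-- This turns the central direction into a space of fixed vectors, to which the key estimate
applies. -/
theorem isCentralMap_iff {π : CombData A} {M : Matrix A A ℝ}
    {Ψ : π.kerOmega →ₗ[ℝ] π.imOmega} :
    π.IsCentralMap M Ψ ↔ ∀ κ : π.kerOmega,
      M.mulVec ((κ : A → ℝ) + (Ψ κ : A → ℝ)) = (κ : A → ℝ) + (Ψ κ : A → ℝ) := by
  refine forall_congr' fun κ => ?_
  rw [Matrix.mulVec_add, sub_eq_sub_iff_add_eq_add, add_comm (M.mulVec (Ψ κ : A → ℝ))]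

/-- Invariance of jumps puts the range of `M - Id` inside `Im Ω_π`. On that space `M - Id` is
injective by `hfix`, hence invertible by finite dimension. -/
theorem HasBlocks.existsUnique_isCentralMap [Nontrivial A] {π : CombData A} (hπ : π.HasBlocks)
    {M : Matrix A A ℝ} (hM : ∀ v, π.jump (M.mulVec v) = π.jump v)
    (hfix : ∀ v, M.mulVec v = v → π.jump v = 0 → v = 0) :
    ∃! Ψ : π.kerOmega →ₗ[ℝ] π.imOmega, π.IsCentralMap M Ψ := by
  have hmem : ∀ v, M.mulVecLin v - v ∈ π.imOmega := fun v => by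
    rw [hπ.imOmega_eq_ker_jump, LinearMap.mem_ker, map_sub, Matrix.mulVecLin_apply, hM, sub_self]
  let D : (A → ℝ) →ₗ[ℝ] π.imOmega := (M.mulVecLin - LinearMap.id).codRestrict π.imOmega hmem
  have hD : ∀ v, (D v : A → ℝ) = M.mulVec v - v := fun v => rfl
  have hinj : Function.Injective (D ∘ₗ π.imOmega.subtype) := by
    rw [← LinearMap.ker_eq_bot, LinearMap.ker_eq_bot']
    rintro ⟨v, hv⟩ h0
    have h1 : M.mulVec v - v = 0 := congrArg Subtype.val h0
    rw [hπ.imOmega_eq_ker_jump] at hv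
    exact Subtype.ext (hfix v (sub_eq_zero.mp h1) hv)
  let e := LinearEquiv.ofInjectiveEndo _ hinj
  have he : ∀ u : π.imOmega, (e u : A → ℝ) = M.mulVec u - u := fun u => rfl
  refine ⟨e.symm.toLinearMap ∘ₗ (-D) ∘ₗ π.kerOmega.subtype, fun κ => ?_, fun Ψ hΨ => ?_⟩
  · have h1 := he (e.symm (-D κ))
    rw [LinearEquiv.apply_symm_apply] at h1
    change M.mulVec (e.symm (-D κ) : A → ℝ) - (e.symm (-D κ) : A → ℝ) = _
    rw [← h1, Submodule.coe_neg, hD, neg_sub]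
  · ext1 κ
    change Ψ κ = e.symm (-D κ)
    rw [LinearEquiv.eq_symm_apply]
    ext1
    rw [he, hΨ κ, Submodule.coe_neg, hD, neg_sub]

theorem isCentralMap_centralMap {π : CombData A} {M : Matrix A A ℝ}
    (h : ∃! Ψ : π.kerOmega →ₗ[ℝ] π.imOmega, π.IsCentralMap M Ψ) :
    π.IsCentralMap M (π.centralMap M) := by
  rw [centralMap, dif_pos h]
  exact h.choose_spec.1

theorem mem_graphSpace {π : CombData A} {Ψ : π.kerOmega →ₗ[ℝ] π.imOmega} {v : A → ℝ} :
    v ∈ π.graphSpace Ψ ↔ ∃ κ : π.kerOmega, (κ : A → ℝ) + (Ψ κ : A → ℝ) = v := Iff.rfl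

theorem HasBlocks.finrank_graphSpace [Nontrivial A] {π : CombData A} (hπ : π.HasBlocks)
    (Ψ : π.kerOmega →ₗ[ℝ] π.imOmega) :
    Module.finrank ℝ (π.graphSpace Ψ) = Fintype.card A - 2 := by
  rw [← hπ.finrank_kerOmega, graphSpace]
  apply LinearMap.finrank_range_of_inj
  rw [← LinearMap.ker_eq_bot, LinearMap.ker_eq_bot']
  intro κ hκ
  have h1 : (κ : A → ℝ) + (Ψ κ : A → ℝ) = 0 := hκ
  have h2 : (κ : A → ℝ) ∈ π.imOmega := by
    rw [eq_neg_of_add_eq_zero_left h1]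
    exact neg_mem (Ψ κ).2
  exact Subtype.ext (Submodule.disjoint_def.mp π.disjoint_kerOmega_imOmega _ κ.2 h2)

theorem HasBlocks.Theta_mulVecLin_injective [Nontrivial A] [DecidableEq A] {π : CombData A}
    (hπ : π.HasBlocks) (ε : Fin 2) : Function.Injective (π.Theta ε).mulVecLin := by
  rw [← LinearMap.ker_eq_bot, LinearMap.ker_eq_bot']
  intro v hv
  have h : ∀ α, v α + (if α = π.lastLetter (1 - ε) then v (π.lastLetter ε) else 0) = 0 := by
    intro α
    rw [← Theta_mulVec]
    exact congrFun hv α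
  have hne : π.lastLetter ε ≠ π.lastLetter (1 - ε) := by
    intro e
    obtain ⟨r, s, t, hb⟩ := hπ.exists_isBlock ε
    have h1 := hb.pos_winner
    have h2 := π.pos_lastLetter (1 - ε)
    rw [← e] at h2
    have := hb.card
    have := hb.left_pos
    have := hb.right_pos
    omega
  have hw := h (π.lastLetter ε)
  rw [if_neg hne, add_zero] at hw
  ext α
  have := h α
  rw [hw] at this
  simpa using this

end CombData

/-! ### Periodic approximations -/

namespace CombSeq

open CombData

variable {A : Type*} [Fintype A] [Nontrivial A] {γ : CombSeq A}

theorem Admissible.exists_foldl_eq (hγ : γ.Admissible) (n : ℕ) :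
    ∃ l : List (Fin 2), l.foldl (fun q δ => rauzy δ q) (γ n).1 = (γ 0).1 := by
  induction n with
  | zero => exact ⟨[], rfl⟩
  | succ n ih =>
    obtain ⟨l, hl⟩ := ih
    obtain ⟨l', hl'⟩ := exists_foldl_rauzy_rauzy (γ n).1 (γ n).2
    exact ⟨l' ++ l, by rw [List.foldl_append, hγ n, hl', hl]⟩

/-- Moves can be undone by moves, so the initial path of `γ` of length `n + 1` extends to a loop at
`π^0`, which is then repeated. The extra step ensures agreement of the type at index `n`. -/
theorem Admissible.nonempty_periodicApprox (hγ : γ.Admissible) (n : ℕ) :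
    Nonempty (γ.PeriodicApprox n) := by
  obtain ⟨l, hl⟩ := hγ.exists_foldl_eq (n + 1)
  let L : List (Fin 2) := List.ofFn (fun i : Fin (n + 1) => (γ i).2) ++ l
  have hLlen : L.length = n + 1 + l.length := by simp [L]; omega
  have hLpos : 0 < L.length := by omega
  let e : ℕ → Fin 2 := fun i => L[i % L.length]'(Nat.mod_lt _ hLpos)
  have he : ∀ i (hi : i < L.length), e i = L[i] := fun i hi => by
    simp only [e, Nat.mod_eq_of_lt hi]
  have heγ : ∀ i < n + 1, e i = (γ i).2 := fun i hi => by
    rw [he i (by omega)]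
    simp only [L]
    rw [List.getElem_append_left (by simpa using hi), List.getElem_ofFn]
  have heper : ∀ i, e (i + L.length) = e i := fun i => by simp [e]
  let q : ℕ → CombData A := fun i => Nat.rec (γ 0).1 (fun i π => rauzy (e i) π) i
  have hq : ∀ i, q (i + 1) = rauzy (e i) (q i) := fun i => rfl
  have hqγ : ∀ i ≤ n + 1, q i = (γ i).1 := by
    intro i
    induction i with
    | zero => intro _; rfl
    | succ i ih =>
      intro hi
      rw [hq, ih (by omega), heγ i (by omega), hγ i]
  have hql : ∀ m ≤ l.length,
      q (n + 1 + m) = (l.take m).foldl (fun q δ => rauzy δ q) (γ (n + 1)).1 := by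
    intro m
    induction m with
    | zero => intro _; exact hqγ _ le_rfl
    | succ m ih =>
      intro hm
      rw [← add_assoc, hq, ih (by omega), he _ (by omega), ← List.take_concat_get' l m (by omega),
        List.foldl_append]
      simp only [L, List.foldl_cons, List.foldl_nil]
      rw [List.getElem_append_right (by simp)]
      simp
  have hqp : q L.length = q 0 := by
    rw [hLlen, hql _ le_rfl, List.take_length, hl]
    rfl
  have hqper : ∀ i, q (i + L.length) = q i := by
    intro i
    induction i with
    | zero => rw [zero_add, hqp]
    | succ i ih => rw [show i + 1 + L.length = i + L.length + 1 by ring, hq, hq, ih, heper]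
  exact ⟨{
    seq := fun i => (q i, e i)
    period := L.length
    period_pos := hLpos
    le_period := by omega
    admissible := fun i => rfl
    agrees := fun i hi => Prod.ext (hqγ i (by omega)) (heγ i (by omega))
    periodic := fun i => Prod.ext (hqper i) (heper i) }⟩

theorem PeriodicApprox.hasBlocks_seq {n : ℕ} (c : γ.PeriodicApprox n) (h0 : (γ 0).1.HasBlocks) :
    (c.seq 0).1.HasBlocks := by
  rw [c.agrees 0 (Nat.zero_le _)]
  exact h0

variable [DecidableEq A] {k n : ℕ}

theorem cocycle_mulVec_fixed {p : ℕ} (hper : ∀ i, γ (i + p) = γ i) {j : ℕ} {v : A → ℝ}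
    (hv : (γ.cocycle j p).mulVec v = v) (m : ℕ) :
    (γ.cocycle (j + m) p).mulVec ((γ.cocycle j m).mulVec v) = (γ.cocycle j m).mulVec v := by
  rw [Matrix.mulVec_mulVec, ← cocycle_add, cocycle_add_period hper hv]

namespace PeriodicApprox

theorem cocycle_eq (c : γ.PeriodicApprox n) {j m : ℕ} (h : j + m ≤ n + 1) :
    c.seq.cocycle j m = γ.cocycle j m :=
  cocycle_congr fun i hi => c.agrees (j + i) (by omega)

theorem jump_loop (c : γ.PeriodicApprox n) (h0 : (γ 0).1.HasBlocks) {j : ℕ} (hj : j ≤ n)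
    (v : A → ℝ) : (γ j).1.jump ((c.loop j).mulVec v) = (γ j).1.jump v := by
  have := c.admissible.jump_cocycle (c.hasBlocks_seq h0) j c.period v
  rwa [c.periodic, c.agrees j hj] at this

theorem norm_le_of_fixed (c : γ.PeriodicApprox n) (h0 : (γ 0).1.HasBlocks) (hk : γ.KBounded k)
    {j : ℕ} (hj : j + 2 * k ≤ n) {v : A → ℝ} (hv : (c.loop j).mulVec v = v) :
    ‖v‖ ≤ (9 + 8 * (2 * k : ℕ)) * Fintype.card A * ‖(γ j).1.jump v‖ := by
  have := c.admissible.norm_le_of_fixed (c.hasBlocks_seq h0) c.period_pos c.periodic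
    (j := j) (K := 2 * k) (fun δ => ?_) hv
  · rwa [c.agrees j (by omega)] at this
  · obtain ⟨i, hi, h⟩ := hk.exists_loser j δ
    refine ⟨i, hi, ?_⟩
    rw [letter, c.agrees (j + i) (by omega)]
    exact h

theorem existsUnique_isCentralMap (c : γ.PeriodicApprox n) (hγ : γ.Admissible)
    (h0 : (γ 0).1.HasBlocks) (hk : γ.KBounded k) {j : ℕ} (hj : j + 2 * k ≤ n) :
    ∃! Ψ : (γ j).1.kerOmega →ₗ[ℝ] (γ j).1.imOmega, (γ j).1.IsCentralMap (c.loop j) Ψ := by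
  refine (hγ.hasBlocks h0 j).existsUnique_isCentralMap (c.jump_loop h0 (by omega)) ?_
  intro v hv hJ
  have := c.norm_le_of_fixed h0 hk hj hv
  rw [hJ, norm_zero, mul_zero] at this
  exact norm_le_zero_iff.mp this

/-- The point of the central direction over `κ`. -/
noncomputable def centralVec (c : γ.PeriodicApprox n) (j : ℕ) (κ : (γ j).1.kerOmega) : A → ℝ :=
  (κ : A → ℝ) + ((γ j).1.centralMap (c.loop j) κ : A → ℝ)

theorem loop_mulVec_centralVec (c : γ.PeriodicApprox n) (hγ : γ.Admissible)
    (h0 : (γ 0).1.HasBlocks) (hk : γ.KBounded k) {j : ℕ} (hj : j + 2 * k ≤ n)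
    (κ : (γ j).1.kerOmega) : (c.loop j).mulVec (c.centralVec j κ) = c.centralVec j κ :=
  isCentralMap_iff.mp (isCentralMap_centralMap (c.existsUnique_isCentralMap hγ h0 hk hj)) κ

theorem jump_centralVec (c : γ.PeriodicApprox n) (hγ : γ.Admissible) (h0 : (γ 0).1.HasBlocks)
    (j : ℕ) (κ : (γ j).1.kerOmega) :
    (γ j).1.jump (c.centralVec j κ) = (γ j).1.jump κ := by
  have := LinearMap.mem_ker.mp ((hγ.hasBlocks h0 j).imOmega_eq_ker_jump.le
    ((γ j).1.centralMap (c.loop j) κ).2)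
  rw [centralVec, map_add, this, add_zero]

theorem norm_centralMap_le (c : γ.PeriodicApprox n) (hγ : γ.Admissible)
    (h0 : (γ 0).1.HasBlocks) (hk : γ.KBounded k) {j : ℕ} (hj : j + 2 * k ≤ n)
    (κ : (γ j).1.kerOmega) : ‖(γ j).1.centralMap (c.loop j) κ‖ ≤
      (9 + 8 * (2 * k : ℕ)) * Fintype.card A * ‖(γ j).1.jump κ‖ + ‖κ‖ := by
  have h1 := c.norm_le_of_fixed h0 hk hj (c.loop_mulVec_centralVec hγ h0 hk hj κ)
  rw [c.jump_centralVec hγ h0] at h1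
  calc ‖(γ j).1.centralMap (c.loop j) κ‖ = ‖c.centralVec j κ - (κ : A → ℝ)‖ := by
        rw [centralVec, add_sub_cancel_left]; rfl
    _ ≤ ‖c.centralVec j κ‖ + ‖(κ : A → ℝ)‖ := norm_sub_le _ _
    _ ≤ _ := by gcongr; rfl

/-- The cocycle maps the central direction at `j` to the central direction at `j + 1`, and the
induced map between the kernels does not depend on the approximation. -/
theorem theta_mulVec_centralVec (c : γ.PeriodicApprox n) (hγ : γ.Admissible)
    (h0 : (γ 0).1.HasBlocks) (hk : γ.KBounded k) {j : ℕ} (hj : j + 1 + 2 * k ≤ n)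
    (κ : (γ j).1.kerOmega) (κ' : (γ (j + 1)).1.kerOmega)
    (hκ : (γ (j + 1)).1.jump κ' = (γ j).1.jump κ) :
    (γ.theta j).mulVec (c.centralVec j κ) = c.centralVec (j + 1) κ' := by
  have h1 := cocycle_mulVec_fixed c.periodic (c.loop_mulVec_centralVec hγ h0 hk (by omega) κ) 1
  have h2 : c.seq.cocycle j 1 = γ.theta j := by
    rw [c.cocycle_eq (by omega)]; simp [cocycle]
  rw [h2] at h1
  have h3 := c.loop_mulVec_centralVec hγ h0 hk hj κ'
  have h4 : (c.loop (j + 1)).mulVec ((γ.theta j).mulVec (c.centralVec j κ) -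
      c.centralVec (j + 1) κ') =
      (γ.theta j).mulVec (c.centralVec j κ) - c.centralVec (j + 1) κ' := by
    rw [Matrix.mulVec_sub, h3]
    congr 1
  have h5 := c.norm_le_of_fixed h0 hk hj h4
  have h6 : (γ (j + 1)).1.jump ((γ.theta j).mulVec (c.centralVec j κ)) = (γ j).1.jump κ := by
    rw [hγ j, theta, (hγ.hasBlocks h0 j).jump_Theta_mulVec, c.jump_centralVec hγ h0]
  rw [map_sub, h6, c.jump_centralVec hγ h0, hκ, sub_self, norm_zero, mul_zero] at h5
  exact sub_eq_zero.mp (norm_le_zero_iff.mp h5)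

theorem norm_cocycle_mulVec_centralVec (c : γ.PeriodicApprox n) (hγ : γ.Admissible)
    (h0 : (γ 0).1.HasBlocks) (hk : γ.KBounded k) {m : ℕ} (hm : m + 2 * k ≤ n)
    (κ : (γ 0).1.kerOmega) :
    ‖(γ.cocycle 0 m).mulVec (c.centralVec 0 κ)‖ ≤
        (9 + 8 * (2 * k : ℕ)) * Fintype.card A * (3 * ‖c.centralVec 0 κ‖) ∧
      ‖c.centralVec 0 κ‖ ≤ (9 + 8 * (2 * k : ℕ)) * Fintype.card A *
        (3 * ‖(γ.cocycle 0 m).mulVec (c.centralVec 0 κ)‖) := by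
  have h1 := c.loop_mulVec_centralVec hγ h0 hk (j := 0) (by omega) κ
  have h2 := cocycle_mulVec_fixed c.periodic h1 m
  rw [c.cocycle_eq (j := 0) (m := m) (by omega)] at h2
  have h3 := c.norm_le_of_fixed h0 hk (j := 0 + m) (by omega) h2
  have h4 := c.norm_le_of_fixed h0 hk (by omega) h1
  have h5 := hγ.jump_cocycle h0 0 m (c.centralVec 0 κ)
  refine ⟨h3.trans ?_, h4.trans ?_⟩
  · rw [h5]
    gcongr
    exact norm_jump_le _ _
  · rw [← h5]
    gcongr
    exact norm_jump_le _ _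

end PeriodicApprox

/-! ### Limits of the central directions -/

theorem exists_isCentralLimit (hγ : γ.Admissible) (h0 : (γ 0).1.HasBlocks) (hk : γ.KBounded k)
    (c : ∀ n, γ.PeriodicApprox n) :
    ∃ (φ : ℕ → ℕ) (Ψ : ∀ j, (γ j).1.kerOmega →ₗ[ℝ] (γ j).1.imOmega),
      StrictMono φ ∧ γ.IsCentralLimit c φ Ψ := by
  let B : ∀ j, Module.Basis (Fin (Module.finrank ℝ (γ j).1.kerOmega)) ℝ (γ j).1.kerOmega :=
    fun j => Module.finBasis ℝ _
  let f : ℕ → ∀ j, Fin (Module.finrank ℝ (γ j).1.kerOmega) → (γ j).1.imOmega :=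
    fun n j i => (γ j).1.centralMap ((c n).loop j) (B j i)
  have hbdd : ∀ j i, ∃ R, ∀ n, ‖f n j i‖ ≤ R := by
    intro j i
    set R := (9 + 8 * (2 * k : ℕ)) * Fintype.card A * ‖(γ j).1.jump (B j i)‖ + ‖B j i‖ with hR
    have hR0 : 0 ≤ R := by positivity
    have hS : ∀ n, 0 ≤ ∑ m ∈ Finset.range n, ‖f m j i‖ := fun n =>
      Finset.sum_nonneg fun _ _ => norm_nonneg _
    -- The sum covers the finitely many orders `n` for which the estimate is not available.
    refine ⟨R + ∑ m ∈ Finset.range (j + 2 * k), ‖f m j i‖, fun n => ?_⟩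
    rcases lt_or_ge n (j + 2 * k) with h | h
    · have := Finset.single_le_sum (f := fun m => ‖f m j i‖) (fun _ _ => norm_nonneg _)
        (Finset.mem_range.mpr h)
      linarith
    · have := (c n).norm_centralMap_le hγ h0 hk h (B j i)
      have := hS (j + 2 * k)
      change ‖(γ j).1.centralMap ((c n).loop j) (B j i)‖ ≤ _
      linarith
  choose R hR using hbdd
  -- Compactness of the countable product gives one subsequence for all `j`, replacing a diagonal
  -- argument.
  have hcomp : IsCompact (Set.pi Set.univ fun j => Set.pi Set.univ fun i =>
      Metric.closedBall (0 : (γ j).1.imOmega) (R j i)) :=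
    isCompact_univ_pi fun j => isCompact_univ_pi fun i => isCompact_closedBall _ _
  obtain ⟨g, -, φ, hφ, hlim⟩ := hcomp.tendsto_subseq (x := f) fun n j _ i _ => by
    simpa using hR j i n
  refine ⟨φ, fun j => (B j).constr ℝ (g j), hφ, fun j κ => ?_⟩
  have hji : ∀ i, Tendsto (fun m => f (φ m) j i) atTop (𝓝 (g j i)) := fun i =>
    tendsto_pi_nhds.mp (tendsto_pi_nhds.mp hlim j) i
  have hsum := tendsto_finsetSum Finset.univ fun i _ =>
    (hji i).const_smul ((B j).repr κ i)
  rw [Module.Basis.constr_apply_fintype]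
  refine hsum.congr fun m => ?_
  conv_rhs => rw [← (B j).sum_repr κ]
  rw [map_sum]
  simp only [map_smul]
  rfl

theorem IsCentralLimit.tendsto_centralVec {c : ∀ n, γ.PeriodicApprox n} {φ : ℕ → ℕ}
    {Ψ : ∀ j, (γ j).1.kerOmega →ₗ[ℝ] (γ j).1.imOmega} (h : γ.IsCentralLimit c φ Ψ) (j : ℕ)
    (κ : (γ j).1.kerOmega) :
    Tendsto (fun m => (c (φ m)).centralVec j κ) atTop (𝓝 ((κ : A → ℝ) + (Ψ j κ : A → ℝ))) :=
  tendsto_const_nhds.add ((continuous_subtype_val.tendsto _).comp (h j κ))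

theorem IsCentralLimit.map_graphSpace {c : ∀ n, γ.PeriodicApprox n} {φ : ℕ → ℕ}
    {Ψ : ∀ j, (γ j).1.kerOmega →ₗ[ℝ] (γ j).1.imOmega} (h : γ.IsCentralLimit c φ Ψ)
    (hφ : StrictMono φ) (hγ : γ.Admissible) (h0 : (γ 0).1.HasBlocks) (hk : γ.KBounded k)
    (j : ℕ) : ((γ j).1.graphSpace (Ψ j)).map (γ.theta j).mulVecLin =
      (γ (j + 1)).1.graphSpace (Ψ (j + 1)) := by
  have hb := hγ.hasBlocks h0
  apply Submodule.eq_of_le_of_finrank_eq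
  · rintro _ ⟨_, ⟨κ, rfl⟩, rfl⟩
    have hmem : (γ.theta j).mulVec (κ : A → ℝ) ∈
        (γ (j + 1)).1.kerOmega ⊔ (γ (j + 1)).1.imOmega := by
      rw [(γ (j + 1)).1.isCompl_kerOmega_imOmega.sup_eq_top]
      trivial
    -- The kernel component `κ'` of `Θ_j κ` does not depend on the approximation, so the relation
    -- between central vectors passes to the limit.
    obtain ⟨κ', hκ', u, hu, hsum⟩ := Submodule.mem_sup.mp hmem
    have hjump : (γ (j + 1)).1.jump κ' = (γ j).1.jump κ := by
      rw [(hb (j + 1)).imOmega_eq_ker_jump, LinearMap.mem_ker] at hu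
      rw [← (hb j).jump_Theta_mulVec (γ j).2, ← hγ j]
      change _ = (γ (j + 1)).1.jump ((γ.theta j).mulVec (κ : A → ℝ))
      rw [← hsum, map_add, hu, add_zero]
    refine mem_graphSpace.mpr ⟨⟨κ', hκ'⟩, ?_⟩
    have l1 := h.tendsto_centralVec (j + 1) ⟨κ', hκ'⟩
    have l2 := ((γ.theta j).mulVecLin.continuous_of_finiteDimensional.tendsto _).comp
      (h.tendsto_centralVec j κ)
    refine tendsto_nhds_unique (l1.congr' ?_) l2
    filter_upwards [hφ.tendsto_atTop.eventually_ge_atTop (j + 1 + 2 * k)] with m hm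
    exact ((c (φ m)).theta_mulVec_centralVec hγ h0 hk hm κ ⟨κ', hκ'⟩ hjump).symm
  · rw [theta, ← (Submodule.equivMapOfInjective _ ((hb j).Theta_mulVecLin_injective (γ j).2)
      ((γ j).1.graphSpace (Ψ j))).finrank_eq, (hb j).finrank_graphSpace,
      (hb (j + 1)).finrank_graphSpace]

theorem IsCentralLimit.norm_cocycle_mulVec {c : ∀ n, γ.PeriodicApprox n} {φ : ℕ → ℕ}
    {Ψ : ∀ j, (γ j).1.kerOmega →ₗ[ℝ] (γ j).1.imOmega} (h : γ.IsCentralLimit c φ Ψ)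
    (hφ : StrictMono φ) (hγ : γ.Admissible) (h0 : (γ 0).1.HasBlocks) (hk : γ.KBounded k)
    {v : A → ℝ} (hv : v ∈ (γ 0).1.graphSpace (Ψ 0)) (m : ℕ) :
    ‖(γ.cocycle 0 m).mulVec v‖ ≤ (9 + 8 * (2 * k : ℕ)) * Fintype.card A * (3 * ‖v‖) ∧
      ‖v‖ ≤ (9 + 8 * (2 * k : ℕ)) * Fintype.card A * (3 * ‖(γ.cocycle 0 m).mulVec v‖) := by
  obtain ⟨κ, rfl⟩ := mem_graphSpace.mp hv
  have l1 := h.tendsto_centralVec 0 κ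
  have l2 := ((γ.cocycle 0 m).mulVecLin.continuous_of_finiteDimensional.tendsto _).comp l1
  have hev : ∀ᶠ i in atTop, m + 2 * k ≤ φ i := hφ.tendsto_atTop.eventually_ge_atTop _
  constructor
  · refine le_of_tendsto_of_tendsto l2.norm ((l1.norm.const_mul _).const_mul _) ?_
    filter_upwards [hev] with i hi
    exact ((c (φ i)).norm_cocycle_mulVec_centralVec hγ h0 hk hi κ).1
  · refine le_of_tendsto_of_tendsto l1.norm ((l2.norm.const_mul _).const_mul _) ?_
    filter_upwards [hev] with i hi
    exact ((c (φ i)).norm_cocycle_mulVec_centralVec hγ h0 hk hi κ).2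

end CombSeq

theorem mainTheorem7 {A : Type*} [Fintype A] [DecidableEq A] [Nontrivial A] (k : ℕ) :
    ∃ C : ℝ, 1 < C ∧
      ∀ γ : CombSeq A, γ.Admissible → (γ 0).1.Irred → (γ 0).1.GenusOne → γ.KBounded k →
        -- periodic approximations of every order exist
        (∀ n, Nonempty (γ.PeriodicApprox n)) ∧
        -- and for every choice of them:
        ∀ c : ∀ n, γ.PeriodicApprox n,
          -- the central directions of the approximations are eventually well defined,
          (∀ j, ∀ᶠ n in atTop,
            ∃! Ψ : (γ j).1.kerOmega →ₗ[ℝ] (γ j).1.imOmega,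
              (γ j).1.IsCentralMap ((c n).loop j) Ψ) ∧
          -- they converge simultaneously along some subsequence,
          (∃ (φ : ℕ → ℕ) (Ψ : ∀ j, (γ j).1.kerOmega →ₗ[ℝ] (γ j).1.imOmega),
            StrictMono φ ∧ γ.IsCentralLimit c φ Ψ) ∧
          -- and every limit is an invariant family of subspaces of dimension `d - 2`
          -- on which the cocycle is a quasi-isometry.
          ∀ (φ : ℕ → ℕ) (Ψ : ∀ j, (γ j).1.kerOmega →ₗ[ℝ] (γ j).1.imOmega),
            StrictMono φ → γ.IsCentralLimit c φ Ψ →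
              (∀ j, Module.finrank ℝ ((γ j).1.graphSpace (Ψ j)) = Fintype.card A - 2) ∧
              (∀ j, ((γ j).1.graphSpace (Ψ j)).map (γ.theta j).mulVecLin =
                (γ (j + 1)).1.graphSpace (Ψ (j + 1))) ∧
              ∀ v ∈ (γ 0).1.graphSpace (Ψ 0), ∀ n : ℕ,
                ‖WithLp.toLp 2 v‖ / C ≤ ‖WithLp.toLp 2 ((γ.cocycle 0 (n + 1)).mulVec v)‖ ∧
                ‖WithLp.toLp 2 ((γ.cocycle 0 (n + 1)).mulVec v)‖ ≤ C * ‖WithLp.toLp 2 v‖ := by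
  -- The factors come from the estimate for fixed vectors, the norm bound `3` of `jump`, and the
  -- passage from sup to Euclidean norm. Adding `2` makes the constant exceed `1`.
  set D : ℝ := (9 + 8 * (2 * k : ℕ)) * Fintype.card A * 3 * Fintype.card A with hD
  have hD0 : 0 ≤ D := by positivity
  refine ⟨D + 2, by linarith, fun γ hγ hirr hg hk => ?_⟩
  have h0 := CombData.hasBlocks_of_irred_of_genusOne hirr hg
  refine ⟨hγ.nonempty_periodicApprox, fun c => ⟨fun j => ?_,
    CombSeq.exists_isCentralLimit hγ h0 hk c, fun φ Ψ hφ hΨ =>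
    ⟨fun j => (hγ.hasBlocks h0 j).finrank_graphSpace _, hΨ.map_graphSpace hφ hγ h0 hk,
      fun v hv n => ?_⟩⟩⟩
  · filter_upwards [eventually_ge_atTop (j + 2 * k)] with n hn
    exact (c n).existsUnique_isCentralMap hγ h0 hk hn
  · obtain ⟨h1, h2⟩ := hΨ.norm_cocycle_mulVec hφ hγ h0 hk hv (n + 1)
    have key : ∀ u w : A → ℝ,
        ‖u‖ ≤ (9 + 8 * (2 * k : ℕ)) * Fintype.card A * (3 * ‖w‖) →
        ‖WithLp.toLp 2 u‖ ≤ (D + 2) * ‖WithLp.toLp 2 w‖ := by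
      intro u w h
      calc ‖WithLp.toLp 2 u‖ ≤ Fintype.card A * ‖u‖ := norm_toLp_le u
        _ ≤ Fintype.card A * ((9 + 8 * (2 * k : ℕ)) * Fintype.card A * (3 * ‖w‖)) := by gcongr
        _ = D * ‖w‖ := by rw [hD]; ring
        _ ≤ (D + 2) * ‖WithLp.toLp 2 w‖ := by
          gcongr
          · linarith
          · exact norm_le_norm_toLp w
    exact ⟨(div_le_iff₀' (by linarith)).mpr (key _ _ h2), key _ _ h1⟩
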